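/- Conventions. A channel with input space $\mathbb{C}^{a}$ and output space $\mathbb{C}^{b}$ is a completely positive, unital linear map $T:\mathcal{B}(\mathbb{C}^{b})\to\mathcal{B}(\mathbb{C}^{a})$ (Heisenberg picture); a channel on $d$-level systems is one with $a=b=d$. For a linear map $T:\mathcal{B}(\mathcal{H}_2)\to\mathcal{B}(\mathcal{H}_1)$ put $$\|T\|_{\rm cb}=\sup\bigl\{\|(T\otimes\mathrm{Id}_n)(A)\| : n\in\mathbb{N},\ A\in\mathcal{B}(\mathcal{H}_2\otimes\mathbb{C}^n),\ \|A\|\le 1\bigr\},$$ where $\|\cdot\|$ is the operator norm. For $M\in\mathbb{N}$ let $\Delta(T,M)=\inf_{E,D}\|ETD-\mathrm{Id}\|_{\rm cb}$, the infimum being over all channels $E:\mathcal{B}(\mathcal{H}_1)\to\mathcal{B}(\mathbb{C}^M)$ and $D:\mathcal{B}(\mathbb{C}^M)\to\mathcal{B}(\mathcal{H}_2)$. A real number $c\ge 0$ is an achievable rate for $T$ if $\lim_{n\to\infty}\Delta(T^{\otimes n},\lfloor 2^{cn}\rfloor)=0$, and the quantum capacity $Q(T)\in[0,\infty]$ of a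 channel $T$ is the supremum of all achievable rates. Let $H_2(r)=-r\log_2 r-(1-r)\log_2(1-r)$. Theorem. Let $d$ be a prime. (i) Let $T$ be a channel on $d$-level systems, and suppose that for some $0<\varepsilon<1/2$ $$\|\mathrm{Id}-T\|_{\rm cb}<2^{-H_2(\varepsilon)/\varepsilon}.$$ Then $$Q(T)\ \ge\ (1-4\varepsilon)\log_2 d-H_2(2\varepsilon).$$ (ii) Consequently, there is a $\delta>0$ (depending only on $d$) such that every channel $T$ on $d$-level systems with $\|\mathrm{Id}-T\|_{\rm cb}<\delta$ has $Q(T)>0$. -/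

import Mathlib

namespace QuantumChannel

/-! Observables of a system with Hilbert space `ℂ^a` (`a` a finite index type) are the matrices
`Matrix a a ℂ`. Channels are described in the Heisenberg picture: a channel with input space `ℂ^a`
and output space `ℂ^b` is a linear map from `Matrix b b ℂ` to `Matrix a a ℂ`. -/

/-- The map `T ⊗ id_n` from operators on `ℂ^b ⊗ ℂ^n` to operators on `ℂ^a ⊗ ℂ^n`: it applies `T` to
each of the `n × n` blocks. -/
def ampliation {a b : Type*} (T : Matrix b b ℂ →ₗ[ℂ] Matrix a a ℂ) (n : ℕ)
    (A : Matrix (b × Fin n) (b × Fin n) ℂ) : Matrix (a × Fin n) (a × Fin n) ℂ :=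
  Matrix.of fun p q => T (Matrix.of fun i j => A (i, p.2) (j, q.2)) p.1 q.1

theorem ampliation_kronecker {a b : Type*} (T : Matrix b b ℂ →ₗ[ℂ] Matrix a a ℂ) (n : ℕ)
    (X : Matrix b b ℂ) (Y : Matrix (Fin n) (Fin n) ℂ) :
    ampliation T n (Matrix.kroneckerMap (· * ·) X Y) = Matrix.kroneckerMap (· * ·) (T X) Y := by
  ext ⟨p, r⟩ ⟨q, s⟩
  have h : (Matrix.of fun i j => Matrix.kroneckerMap (· * ·) X Y (i, r) (j, s)) = Y r s • X := by
    ext i j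
    simp [mul_comm]
  change T (Matrix.of fun i j => Matrix.kroneckerMap (· * ·) X Y (i, r) (j, s)) p q = T X p q * Y r s
  rw [h, map_smul, Matrix.smul_apply, smul_eq_mul, mul_comm]

section Positivity

open scoped ComplexOrder

/-- Complete positivity: every `T ⊗ id_n` maps positive operators to positive operators. -/
def IsCompletelyPositive {a b : Type*} (T : Matrix b b ℂ →ₗ[ℂ] Matrix a a ℂ) : Prop :=
  ∀ (n : ℕ) (A : Matrix (b × Fin n) (b × Fin n) ℂ), A.PosSemidef → (ampliation T n A).PosSemidef

end Positivity

/-- A quantum channel in the Heisenberg picture: a completely positive unital map. -/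
structure IsChannel {a b : Type*} [DecidableEq a] [DecidableEq b]
    (T : Matrix b b ℂ →ₗ[ℂ] Matrix a a ℂ) : Prop where
  completelyPositive : IsCompletelyPositive T
  unital : T 1 = 1

section CbNorm

open scoped Matrix.Norms.L2Operator

/-- The norm of complete boundedness: the supremum of `‖(T ⊗ id_n)(A)‖` over all `n` and all `A` with
`‖A‖ ≤ 1`, both norms being operator norms with respect to the Euclidean norms of the Hilbert
spaces. -/
noncomputable def cbNorm {a b : Type*} [Fintype a] [DecidableEq a] [Fintype b] [DecidableEq b]
    (T : Matrix b b ℂ →ₗ[ℂ] Matrix a a ℂ) : ENNReal :=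
  ⨆ (n : ℕ) (A : Matrix (b × Fin n) (b × Fin n) ℂ) (_ : ‖A‖ ≤ 1), ‖ampliation T n A‖ₑ

end CbNorm

/-- The tensor power `T^{⊗ n}`, where `(ℂ^a)^{⊗ n}` is `ℂ^(Fin n → a)`: on matrix units it is
`T^{⊗ n}(⊗ₖ e_{iₖ jₖ}) = ⊗ₖ T(e_{iₖ jₖ})`. -/
noncomputable def tensorPower {a b : Type*} [Fintype b] [DecidableEq b]
    (T : Matrix b b ℂ →ₗ[ℂ] Matrix a a ℂ) (n : ℕ) :
    Matrix (Fin n → b) (Fin n → b) ℂ →ₗ[ℂ] Matrix (Fin n → a) (Fin n → a) ℂ where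
  toFun A := Matrix.of fun p q =>
    ∑ i, ∑ j, A i j * ∏ k, T (Matrix.single (i k) (j k) 1) (p k) (q k)
  map_add' A B := by
    ext p q
    simp [add_mul, Finset.sum_add_distrib]
  map_smul' c A := by
    ext p q
    simp [Finset.mul_sum, mul_assoc]

/-- `T^{⊗ n}(X₁ ⊗ ⋯ ⊗ Xₙ) = T(X₁) ⊗ ⋯ ⊗ T(Xₙ)`. -/
theorem tensorPower_prod {a b : Type*} [Fintype b] [DecidableEq b]
    (T : Matrix b b ℂ →ₗ[ℂ] Matrix a a ℂ) (n : ℕ) (X : Fin n → Matrix b b ℂ) :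
    tensorPower T n (Matrix.of fun i j => ∏ k, X k (i k) (j k)) =
      Matrix.of fun p q => ∏ k, T (X k) (p k) (q k) := by
  have hT : ∀ (Y : Matrix b b ℂ) (p q : a),
      T Y p q = ∑ x : b × b, Y x.1 x.2 * T (Matrix.single x.1 x.2 1) p q := by
    intro Y p q
    conv_lhs => rw [Matrix.matrix_eq_sum_single Y]
    rw [Fintype.sum_prod_type]
    simp only [map_sum, Matrix.sum_apply]
    refine Finset.sum_congr rfl fun i _ => Finset.sum_congr rfl fun j _ => ?_
    have : Matrix.single i j (Y i j) = Y i j • Matrix.single i j (1 : ℂ) := by simp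
    rw [this, map_smul]
    rfl
  ext p q
  have hR : (∏ k, T (X k) (p k) (q k)) =
      ∏ k, ∑ x : b × b, X k x.1 x.2 * T (Matrix.single x.1 x.2 1) (p k) (q k) :=
    Finset.prod_congr rfl fun k _ => hT _ _ _
  simp only [tensorPower, LinearMap.coe_mk, AddHom.coe_mk, Matrix.of_apply,
    ← Finset.prod_mul_distrib]
  rw [hR, Finset.prod_univ_sum, Fintype.piFinset_univ, ← Fintype.sum_prod_type']
  exact (Equiv.sum_comp (Equiv.arrowProdEquivProdArrow (Fin n) (fun _ => b) (fun _ => b))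
    (fun x : (Fin n → b) × (Fin n → b) =>
      ∏ k, X k (x.1 k) (x.2 k) * T (Matrix.single (x.1 k) (x.2 k) 1) (p k) (q k))).symm

/-- `Δ(T, M)`: the infimum of `‖E T D - Id‖_cb` over all encoding channels `E` and decoding
channels `D` for an `M`-dimensional system. -/
noncomputable def codingError {a b : Type*} [Fintype a] [DecidableEq a] [Fintype b] [DecidableEq b]
    (T : Matrix b b ℂ →ₗ[ℂ] Matrix a a ℂ) (M : ℕ) : ENNReal :=
  ⨅ (E : Matrix a a ℂ →ₗ[ℂ] Matrix (Fin M) (Fin M) ℂ)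
    (D : Matrix (Fin M) (Fin M) ℂ →ₗ[ℂ] Matrix b b ℂ)
    (_ : IsChannel E) (_ : IsChannel D),
    cbNorm (E ∘ₗ T ∘ₗ D - LinearMap.id)

/-- `c ≥ 0` is an achievable rate for `T` if `Δ(T^{⊗ n}, ⌊2^{cn}⌋) → 0` as `n → ∞`. -/
def IsAchievableRate {a b : Type*} [Fintype a] [DecidableEq a] [Fintype b] [DecidableEq b]
    (T : Matrix b b ℂ →ₗ[ℂ] Matrix a a ℂ) (c : ℝ) : Prop :=
  0 ≤ c ∧ Filter.Tendsto (fun n : ℕ => codingError (tensorPower T n) ⌊(2 : ℝ) ^ (c * (n : ℝ))⌋₊)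
    Filter.atTop (nhds 0)

/-- The quantum capacity `Q(T)`: the supremum of all achievable rates, in the extended reals. -/
noncomputable def quantumCapacity {a b : Type*} [Fintype a] [DecidableEq a] [Fintype b]
    [DecidableEq b] (T : Matrix b b ℂ →ₗ[ℂ] Matrix a a ℂ) : EReal :=
  sSup ((fun c : ℝ => (c : EReal)) '' {c : ℝ | IsAchievableRate T c})

/-- The Shannon entropy `H₂(r)`, in bits, of the distribution `(r, 1 - r)`. -/
noncomputable def shannonEntropy (r : ℝ) : ℝ :=
  -r * Real.logb 2 r - (1 - r) * Real.logb 2 (1 - r)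

end QuantumChannel

/-! Write `T = id + (T - id)` and expand the tensor power over the set `S` of sites carrying `T -
id`. For `|S| ≤ f = ⌊εn⌋` the corresponding term is a combination of maps `A ↦ W_x* A W_y` with
product Weyl operators of weight at most `f`. A pure code sends its code space under these operators
to mutually orthogonal subspaces, so encoder and decoder turn the term into a scalar multiple of the
identity (`exists_encoder_comp_decoder`). Evaluation at `1`, which `T - id` annihilates, shows that
the scalar is `0` unless `S = ∅`. Hence only the terms with `|S| > f` contribute to the coding
error, each at most `δ ^ |S|` if `δ` bounds the cb norm of `T - id` (`codingError_le`). Their sum is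
at most `exp (n (ε log δ + H(ε)))`, with `H` in nats (`sum_pow_card_le`), and this decays exactly
when `δ` is below the threshold of (i).

The codes are graph codes: code vectors are quadratic phases over a finite field with `q` elements,
and character sums turn orthogonality into a linear condition on `[G + Gᵀ, B]`
(`DetectsErrors.isPureCode`). Counting all pairs `(G, B)` shows that some pair works once `C(n, 2f)
q^(4f+k) < q^n` (`exists_detectsErrors`). With `f ≈ εn` this allows every rate below `(1 - 4ε) log₂
q - H₂(2ε)`. Part (ii) follows because this bound is positive for small `ε`. -/

namespace QuantumChannel

open scoped Matrix

set_option linter.unusedSectionVars false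

/-! ### Operator norm estimates and the cb norm. -/

section Norms

open scoped Matrix.Norms.L2Operator

/-- Reindexing is a star homomorphism of C*-algebras, hence contractive. -/
theorem norm_submatrix_equiv_le {m n : Type*} [Fintype m] [DecidableEq m] [Fintype n]
    [DecidableEq n] (e : n ≃ m) (A : Matrix m m ℂ) : ‖A.submatrix e e‖ ≤ ‖A‖ := by
  let φ : Matrix m m ℂ →⋆ₐ[ℂ] Matrix n n ℂ :=
    { Matrix.reindexAlgEquiv ℂ ℂ e.symm with
      map_zero' := by simp
      map_one' := by simp
      map_mul' := by simp
      commutes' := by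
        intro r
        ext i j
        simp [Matrix.algebraMap_matrix_apply, Matrix.submatrix_apply]
      map_star' := by
        intro B
        ext i j
        simp [Matrix.star_apply] }
  exact NonUnitalStarAlgHom.norm_apply_le φ A

theorem norm_submatrix_equiv {m n : Type*} [Fintype m] [DecidableEq m] [Fintype n]
    [DecidableEq n] (e : n ≃ m) (A : Matrix m m ℂ) : ‖A.submatrix e e‖ = ‖A‖ := by
  refine le_antisymm (norm_submatrix_equiv_le e A) ?_
  have h := norm_submatrix_equiv_le e.symm (A.submatrix e e)
  simpa [Matrix.submatrix_submatrix] using h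

theorem norm_blockDiagonal_const_le {m o : Type*} [Fintype m] [DecidableEq m] [Fintype o]
    [DecidableEq o] (A : Matrix m m ℂ) : ‖Matrix.blockDiagonal (fun _ : o => A)‖ ≤ ‖A‖ := by
  let φ : Matrix m m ℂ →⋆ₐ[ℂ] Matrix (m × o) (m × o) ℂ :=
    { toFun := fun A => Matrix.blockDiagonal (fun _ : o => A)
      map_zero' := Matrix.blockDiagonal_zero
      map_one' := Matrix.blockDiagonal_one
      map_add' := fun A B => Matrix.blockDiagonal_add (fun _ : o => A) (fun _ => B)
      map_mul' := fun A B => Matrix.blockDiagonal_mul (fun _ : o => A) (fun _ => B)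
      commutes' := by
        intro r
        ext ⟨i, k⟩ ⟨j, l⟩
        simp only [Matrix.blockDiagonal_apply, Matrix.algebraMap_matrix_apply, Prod.mk.injEq]
        split_ifs <;> simp_all
      map_star' := by
        intro B
        simp only [Matrix.star_eq_conjTranspose, Matrix.blockDiagonal_conjTranspose] }
  exact NonUnitalStarAlgHom.norm_apply_le φ A

/-- Stacking the `K j` gives an isometry `S`, and the sum is the compression `S* (A ⊗ 1) S`
(Stinespring form). -/
theorem norm_sum_conjTranspose_mul_mul_le {m n J : Type*} [Fintype m] [DecidableEq m] [Fintype n]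
    [DecidableEq n] [Fintype J] [DecidableEq J] (K : J → Matrix m n ℂ)
    (hK : ∑ j, (K j)ᴴ * K j = 1) (A : Matrix m m ℂ) :
    ‖∑ j, (K j)ᴴ * A * K j‖ ≤ ‖A‖ := by
  let S : Matrix (m × J) n ℂ := Matrix.of fun p q => K p.2 p.1 q
  have hS : ∀ B : Matrix m m ℂ,
      Sᴴ * Matrix.blockDiagonal (fun _ : J => B) * S = ∑ j, (K j)ᴴ * B * K j := by
    intro B
    ext p q
    simp only [S, Matrix.mul_apply, Matrix.sum_apply, Matrix.conjTranspose_apply, Matrix.of_apply,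
      Matrix.blockDiagonal_apply, Fintype.sum_prod_type]
    rw [Finset.sum_comm]
    refine Finset.sum_congr rfl fun j _ => Finset.sum_congr rfl fun i _ => ?_
    congr 1
    refine Finset.sum_congr rfl fun i' _ => ?_
    simp
  have h1 : Sᴴ * S = 1 := by
    have := hS 1
    rw [show (fun _ : J => (1 : Matrix m m ℂ)) = 1 from rfl, Matrix.blockDiagonal_one] at this
    simpa [hK] using this
  have h2 : ‖S‖ * ‖S‖ ≤ 1 := by
    rw [← Matrix.l2_opNorm_conjTranspose_mul_self, h1, ← Matrix.diagonal_one,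
      Matrix.l2_opNorm_diagonal]
    -- Only `≤ 1` is claimed: for an empty index type the norm of `1` is `0`.
    exact (pi_norm_le_iff_of_nonneg zero_le_one).2 fun _ => by simp
  have h3 : ‖S‖ ≤ 1 := by nlinarith [norm_nonneg S]
  rw [← hS]
  calc ‖Sᴴ * Matrix.blockDiagonal (fun _ : J => A) * S‖
      ≤ ‖Sᴴ‖ * ‖Matrix.blockDiagonal (fun _ : J => A)‖ * ‖S‖ :=
        (Matrix.l2_opNorm_mul _ _).trans
          (mul_le_mul_of_nonneg_right (Matrix.l2_opNorm_mul _ _) (norm_nonneg _))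
    _ ≤ 1 * ‖A‖ * 1 := by
        rw [Matrix.l2_opNorm_conjTranspose]
        gcongr
        exact norm_blockDiagonal_const_le A
    _ = ‖A‖ := by ring

/-- `‖T ⊗ id_n‖ ≤ C` for all `n`. -/
def CbBound {a b : Type*} [Fintype a] [DecidableEq a] [Fintype b] [DecidableEq b]
    (T : Matrix b b ℂ →ₗ[ℂ] Matrix a a ℂ) (C : ℝ) : Prop :=
  ∀ (n : ℕ) (A : Matrix (b × Fin n) (b × Fin n) ℂ), ‖ampliation T n A‖ ≤ C * ‖A‖

section CbBound

variable {a b c : Type*} [Fintype a] [DecidableEq a] [Fintype b] [DecidableEq b]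
  [Fintype c] [DecidableEq c]

theorem ampliation_smul (T : Matrix b b ℂ →ₗ[ℂ] Matrix a a ℂ) (n : ℕ) (r : ℂ)
    (A : Matrix (b × Fin n) (b × Fin n) ℂ) : ampliation T n (r • A) = r • ampliation T n A := by
  ext p q
  change T (r • Matrix.of fun i j => A (i, p.2) (j, q.2)) p.1 q.1 = _
  rw [map_smul]
  rfl

theorem ampliation_sum {ι : Type*} (s : Finset ι) (T : ι → Matrix b b ℂ →ₗ[ℂ] Matrix a a ℂ)
    (n : ℕ) (A : Matrix (b × Fin n) (b × Fin n) ℂ) :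
    ampliation (∑ i ∈ s, T i) n A = ∑ i ∈ s, ampliation (T i) n A := by
  ext p q
  simp [ampliation, Matrix.sum_apply, LinearMap.sum_apply]

theorem CbBound.cbNorm_le {T : Matrix b b ℂ →ₗ[ℂ] Matrix a a ℂ} {C : ℝ} (hC : 0 ≤ C)
    (h : CbBound T C) : cbNorm T ≤ ENNReal.ofReal C := by
  refine iSup_le fun n => iSup_le fun A => iSup_le fun hA => ?_
  rw [← ofReal_norm]
  exact ENNReal.ofReal_le_ofReal ((h n A).trans (by nlinarith [norm_nonneg A]))

theorem cbBound_of_cbNorm_le {T : Matrix b b ℂ →ₗ[ℂ] Matrix a a ℂ} {C : ℝ} (hC : 0 ≤ C)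
    (h : cbNorm T ≤ ENNReal.ofReal C) : CbBound T C := by
  intro n A
  by_cases hA : A = 0
  · subst hA
    have : ampliation T n (0 : Matrix (b × Fin n) (b × Fin n) ℂ) = 0 := by
      simpa using ampliation_smul T n 0 0
    simp [this]
  have hA' : 0 < ‖A‖ := norm_pos_iff.2 hA
  have h1 : ‖((‖A‖⁻¹ : ℝ) : ℂ) • A‖ ≤ 1 := by
    rw [norm_smul, Complex.norm_real, norm_inv, norm_norm, inv_mul_cancel₀ hA'.ne']
  have h2 : ‖ampliation T n (((‖A‖⁻¹ : ℝ) : ℂ) • A)‖ₑ ≤ ENNReal.ofReal C := by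
    refine le_trans ?_ h
    unfold cbNorm
    refine le_iSup_of_le n ?_
    refine le_iSup_of_le (((‖A‖⁻¹ : ℝ) : ℂ) • A) ?_
    exact le_iSup_of_le h1 le_rfl
  rw [← ofReal_norm, ENNReal.ofReal_le_ofReal_iff hC, ampliation_smul, norm_smul,
    Complex.norm_real, norm_inv, norm_norm] at h2
  rwa [inv_mul_le_iff₀ hA', mul_comm] at h2

theorem CbBound.comp {S : Matrix b b ℂ →ₗ[ℂ] Matrix a a ℂ} {T : Matrix c c ℂ →ₗ[ℂ] Matrix b b ℂ}
    {C C' : ℝ} (hC : 0 ≤ C) (hS : CbBound S C) (hT : CbBound T C') :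
    CbBound (S ∘ₗ T) (C * C') := by
  intro n A
  have h : ampliation (S ∘ₗ T) n A = ampliation S n (ampliation T n A) := rfl
  rw [h, mul_assoc]
  exact (hS n _).trans (mul_le_mul_of_nonneg_left (hT n A) hC)

theorem CbBound.sum {ι : Type*} {s : Finset ι} {T : ι → Matrix b b ℂ →ₗ[ℂ] Matrix a a ℂ}
    {C : ι → ℝ} (h : ∀ i ∈ s, CbBound (T i) (C i)) : CbBound (∑ i ∈ s, T i) (∑ i ∈ s, C i) := by
  intro n A
  rw [ampliation_sum, Finset.sum_mul]
  exact norm_sum_le_of_le _ fun i hi => h i hi n A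

theorem CbBound.neg {T : Matrix b b ℂ →ₗ[ℂ] Matrix a a ℂ} {C : ℝ} (h : CbBound T C) :
    CbBound (-T) C := by
  intro n A
  have h' : ampliation (-T) n A = -ampliation T n A := rfl
  rw [h', norm_neg]
  exact h n A

theorem cbBound_id : CbBound (LinearMap.id : Matrix b b ℂ →ₗ[ℂ] Matrix b b ℂ) 1 := by
  intro n A
  rw [one_mul]
  exact le_rfl

/-- A bound for `‖T ⊗ id_n‖` also holds for an arbitrary finite ancilla. -/
theorem CbBound.norm_le {T : Matrix b b ℂ →ₗ[ℂ] Matrix a a ℂ} {C : ℝ} (h : CbBound T C)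
    {ι : Type*} [Fintype ι] [DecidableEq ι] (A : Matrix (b × ι) (b × ι) ℂ) :
    ‖(Matrix.of fun p q => T (Matrix.of fun i j => A (i, p.2) (j, q.2)) p.1 q.1 :
      Matrix (a × ι) (a × ι) ℂ)‖ ≤ C * ‖A‖ := by
  let e := Fintype.equivFin ι
  have h1 := h (Fintype.card ι) (A.submatrix ((Equiv.refl b).prodCongr e.symm)
    ((Equiv.refl b).prodCongr e.symm))
  rw [norm_submatrix_equiv] at h1
  refine le_trans (le_of_eq ?_) h1
  rw [← norm_submatrix_equiv ((Equiv.refl a).prodCongr e.symm)]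
  rfl

end CbBound

/-! ### Channels given by Kraus operators. -/

section Kraus

variable {a b J : Type*} [Fintype a] [DecidableEq a] [Fintype b] [DecidableEq b]
  [Fintype J] [DecidableEq J]

/-- The map `A ↦ ∑ⱼ Kⱼ* A Kⱼ`. -/
noncomputable def krausMap (K : J → Matrix b a ℂ) : Matrix b b ℂ →ₗ[ℂ] Matrix a a ℂ where
  toFun A := ∑ j, (K j)ᴴ * A * K j
  map_add' A B := by simp only [Matrix.mul_add, Matrix.add_mul, Finset.sum_add_distrib]
  map_smul' r A := by
    rw [RingHom.id_apply, Finset.smul_sum]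
    exact Finset.sum_congr rfl fun j _ => by rw [Matrix.mul_smul, Matrix.smul_mul]

theorem krausMap_apply (K : J → Matrix b a ℂ) (A : Matrix b b ℂ) :
    krausMap K A = ∑ j, (K j)ᴴ * A * K j := rfl

theorem ampliation_krausMap (K : J → Matrix b a ℂ) (n : ℕ)
    (A : Matrix (b × Fin n) (b × Fin n) ℂ) :
    ampliation (krausMap K) n A =
      ∑ j, (Matrix.blockDiagonal fun _ : Fin n => K j)ᴴ * A *
        Matrix.blockDiagonal fun _ : Fin n => K j := by
  ext ⟨p, r⟩ ⟨q, s⟩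
  simp only [ampliation, krausMap_apply, Matrix.of_apply, Matrix.sum_apply]
  refine Finset.sum_congr rfl fun j _ => ?_
  rw [Matrix.blockDiagonal_conjTranspose]
  simp [Matrix.mul_apply, Matrix.blockDiagonal_apply, Fintype.sum_prod_type, ite_mul, mul_ite,
    Finset.sum_mul]

theorem sum_blockDiagonal_eq_one (K : J → Matrix b a ℂ) (hK : ∑ j, (K j)ᴴ * K j = 1) (n : ℕ) :
    ∑ j, (Matrix.blockDiagonal fun _ : Fin n => K j)ᴴ *
      Matrix.blockDiagonal (fun _ : Fin n => K j) = 1 := by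
  have h : ∀ j, (Matrix.blockDiagonal fun _ : Fin n => K j)ᴴ *
      Matrix.blockDiagonal (fun _ : Fin n => K j) =
      Matrix.blockDiagonalAddMonoidHom a a (Fin n) ℂ (fun _ => (K j)ᴴ * K j) := by
    intro j
    rw [Matrix.blockDiagonal_conjTranspose, ← Matrix.blockDiagonal_mul]
    rfl
  simp_rw [h]
  rw [← map_sum]
  have : (∑ j, fun _ : Fin n => (K j)ᴴ * K j) = 1 := by
    ext1 i
    simp [Finset.sum_apply, hK]
  rw [this]
  exact Matrix.blockDiagonal_one

open scoped ComplexOrder in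
theorem isChannel_krausMap (K : J → Matrix b a ℂ) (hK : ∑ j, (K j)ᴴ * K j = 1) :
    IsChannel (krausMap K) where
  completelyPositive := by
    intro n A hA
    rw [ampliation_krausMap]
    exact Matrix.posSemidef_sum _ fun j _ => hA.conjTranspose_mul_mul_same _
  unital := by simp [krausMap_apply, hK]

theorem cbBound_krausMap (K : J → Matrix b a ℂ) (hK : ∑ j, (K j)ᴴ * K j = 1) :
    CbBound (krausMap K) 1 := by
  intro n A
  rw [ampliation_krausMap, one_mul]
  exact norm_sum_conjTranspose_mul_mul_le _ (sum_blockDiagonal_eq_one K hK n) A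

end Kraus

end Norms

/-! ### Tensor products of linear maps and their cb bounds. -/

section TensorMap

variable {b : Type*} [Fintype b] [DecidableEq b] {n : ℕ}

/-- The tensor product `L₁ ⊗ ⋯ ⊗ Lₙ` of linear maps. -/
noncomputable def tensorMap (L : Fin n → Matrix b b ℂ →ₗ[ℂ] Matrix b b ℂ) :
    Matrix (Fin n → b) (Fin n → b) ℂ →ₗ[ℂ] Matrix (Fin n → b) (Fin n → b) ℂ where
  toFun A := Matrix.of fun p q =>
    ∑ i, ∑ j, A i j * ∏ k, L k (Matrix.single (i k) (j k) 1) (p k) (q k)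
  map_add' A B := by
    ext p q
    simp [add_mul, Finset.sum_add_distrib]
  map_smul' c A := by
    ext p q
    simp [Finset.mul_sum, mul_assoc]

theorem tensorMap_apply (L : Fin n → Matrix b b ℂ →ₗ[ℂ] Matrix b b ℂ)
    (A : Matrix (Fin n → b) (Fin n → b) ℂ) (p q : Fin n → b) :
    tensorMap L A p q = ∑ i, ∑ j, A i j * ∏ k, L k (Matrix.single (i k) (j k) 1) (p k) (q k) :=
  rfl

theorem tensorPower_eq_tensorMap (T : Matrix b b ℂ →ₗ[ℂ] Matrix b b ℂ) :
    tensorPower T n = tensorMap fun _ : Fin n => T := rfl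

/-- The product operator `X₁ ⊗ ⋯ ⊗ Xₙ`. -/
def pureTensor {a b : Type*} (X : Fin n → Matrix a b ℂ) : Matrix (Fin n → a) (Fin n → b) ℂ :=
  Matrix.of fun i j => ∏ k, X k (i k) (j k)

theorem pureTensor_apply {a b : Type*} (X : Fin n → Matrix a b ℂ) (i : Fin n → a)
    (j : Fin n → b) : pureTensor X i j = ∏ k, X k (i k) (j k) := rfl

theorem single_eq_pureTensor (i j : Fin n → b) :
    Matrix.single i j (1 : ℂ) = pureTensor fun k => Matrix.single (i k) (j k) (1 : ℂ) := by
  ext p q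
  simp only [pureTensor_apply, Matrix.single_apply, Finset.prod_ite_zero, Finset.prod_const_one,
    Finset.mem_univ, forall_true_left, forall_and, funext_iff]

theorem pureTensor_one : pureTensor (fun _ : Fin n => (1 : Matrix b b ℂ)) = 1 := by
  ext p q
  simp only [pureTensor_apply, Matrix.one_apply, Finset.prod_ite_zero, Finset.prod_const_one,
    Finset.mem_univ, forall_true_left, funext_iff]

theorem apply_eq_sum_single (L : Matrix b b ℂ →ₗ[ℂ] Matrix b b ℂ) (Y : Matrix b b ℂ) (p q : b) :
    L Y p q = ∑ i, ∑ j, Y i j * L (Matrix.single i j 1) p q := by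
  conv_lhs => rw [Matrix.matrix_eq_sum_single Y]
  simp only [map_sum, Matrix.sum_apply]
  refine Finset.sum_congr rfl fun i _ => Finset.sum_congr rfl fun j _ => ?_
  have : Matrix.single i j (Y i j) = Y i j • Matrix.single i j (1 : ℂ) := by simp
  rw [this, map_smul]
  rfl

theorem sum_sum_prod {ι κ : Type*} [Fintype ι] [DecidableEq ι] [Fintype κ] [DecidableEq κ]
    (g : Fin n → ι → κ → ℂ) :
    ∏ k, ∑ i, ∑ j, g k i j = ∑ x : Fin n → ι, ∑ y : Fin n → κ, ∏ k, g k (x k) (y k) := by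
  simp_rw [← Fintype.sum_prod_type']
  rw [Finset.prod_univ_sum, Fintype.piFinset_univ]
  exact (Equiv.sum_comp (Equiv.arrowProdEquivProdArrow (Fin n) (fun _ => ι) (fun _ => κ))
    (fun x : (Fin n → ι) × (Fin n → κ) => ∏ k, g k (x.1 k) (x.2 k)))

theorem tensorMap_pureTensor (L : Fin n → Matrix b b ℂ →ₗ[ℂ] Matrix b b ℂ)
    (X : Fin n → Matrix b b ℂ) :
    tensorMap L (pureTensor X) = pureTensor fun k => L k (X k) := by
  ext p q
  simp only [tensorMap_apply, pureTensor_apply, ← Finset.prod_mul_distrib]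
  rw [Finset.prod_congr rfl fun k _ => apply_eq_sum_single (L k) (X k) (p k) (q k), sum_sum_prod]

/-- Matrix units are product operators, so product operators span. -/
theorem ext_pureTensor {M : Type*} [AddCommMonoid M] [Module ℂ M]
    {f g : Matrix (Fin n → b) (Fin n → b) ℂ →ₗ[ℂ] M}
    (h : ∀ X : Fin n → Matrix b b ℂ, f (pureTensor X) = g (pureTensor X)) : f = g := by
  refine Matrix.ext_linearMap ℂ fun i j => LinearMap.ext_ring ?_
  have := h fun k => Matrix.single (i k) (j k) (1 : ℂ)
  rw [← single_eq_pureTensor] at this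
  exact this

theorem tensorMap_comp (L L' : Fin n → Matrix b b ℂ →ₗ[ℂ] Matrix b b ℂ) :
    tensorMap (fun k => L k ∘ₗ L' k) = tensorMap L ∘ₗ tensorMap L' :=
  ext_pureTensor fun X => by
    simp only [LinearMap.comp_apply, tensorMap_pureTensor]

theorem tensorMap_id :
    tensorMap (fun _ : Fin n => (LinearMap.id : Matrix b b ℂ →ₗ[ℂ] Matrix b b ℂ)) =
      LinearMap.id :=
  ext_pureTensor fun X => by
    simp only [LinearMap.id_apply, tensorMap_pureTensor]

theorem tensorPower_one (T : Matrix b b ℂ →ₗ[ℂ] Matrix b b ℂ) (hT : T 1 = 1) :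
    tensorPower T n 1 = 1 := by
  rw [tensorPower_eq_tensorMap, ← pureTensor_one, tensorMap_pureTensor, hT]

/-- Distributivity on product operators; `S` records the sites where `L` is chosen. It is applied
with `L = T - id` and `L' = id`. -/
theorem tensorMap_add (L L' : Fin n → Matrix b b ℂ →ₗ[ℂ] Matrix b b ℂ) :
    tensorMap (fun k => L k + L' k) =
      ∑ S : Finset (Fin n), tensorMap fun k => if k ∈ S then L k else L' k := by
  refine ext_pureTensor fun X => ?_
  simp only [LinearMap.sum_apply, tensorMap_pureTensor]
  ext p q
  simp only [Matrix.sum_apply, pureTensor_apply, LinearMap.add_apply, Matrix.add_apply]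
  rw [Finset.prod_add, Finset.powerset_univ]
  refine Finset.sum_congr rfl fun S _ => ?_
  rw [← Finset.prod_mul_prod_compl S fun k => (if k ∈ S then L k else L' k) (X k) (p k) (q k),
    Finset.compl_eq_univ_sdiff]
  congr 1
  · exact Finset.prod_congr rfl fun k hk => by rw [if_pos hk]
  · exact Finset.prod_congr rfl fun k hk => by rw [if_neg (Finset.mem_sdiff.1 hk).2]

/-- The map `id ⊗ ⋯ ⊗ L ⊗ ⋯ ⊗ id` acting on the site `k`. -/
noncomputable def siteMap (k : Fin n) (L : Matrix b b ℂ →ₗ[ℂ] Matrix b b ℂ) :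
    Matrix (Fin n → b) (Fin n → b) ℂ →ₗ[ℂ] Matrix (Fin n → b) (Fin n → b) ℂ where
  toFun A := Matrix.of fun p q =>
    L (Matrix.of fun s t => A (Function.update p k s) (Function.update q k t)) (p k) (q k)
  map_add' A B := by
    ext p q
    change L ((Matrix.of fun s t => A (Function.update p k s) (Function.update q k t)) +
      Matrix.of fun s t => B (Function.update p k s) (Function.update q k t)) (p k) (q k) = _
    rw [map_add]
    rfl
  map_smul' c A := by
    ext p q
    change L (c • Matrix.of fun s t => A (Function.update p k s) (Function.update q k t))
      (p k) (q k) = _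
    rw [map_smul]
    rfl

theorem tensorMap_update_id (k : Fin n) (L : Matrix b b ℂ →ₗ[ℂ] Matrix b b ℂ) :
    tensorMap (Function.update (fun _ => LinearMap.id) k L) = siteMap k L := by
  refine ext_pureTensor fun X => ?_
  rw [tensorMap_pureTensor]
  ext p q
  have h : (Matrix.of fun s t => pureTensor X (Function.update p k s) (Function.update q k t)) =
      (∏ l ∈ Finset.univ.erase k, X l (p l) (q l)) • X k := by
    ext s t
    rw [Matrix.of_apply, pureTensor_apply, ← Finset.prod_erase_mul _ _ (Finset.mem_univ k),
      Matrix.smul_apply, smul_eq_mul, Function.update_self, Function.update_self]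
    congr 1
    refine Finset.prod_congr rfl fun l hl => ?_
    rw [Function.update_of_ne (Finset.ne_of_mem_erase hl),
      Function.update_of_ne (Finset.ne_of_mem_erase hl)]
  change _ = L (Matrix.of fun s t => pureTensor X (Function.update p k s)
    (Function.update q k t)) (p k) (q k)
  rw [h, map_smul, Matrix.smul_apply, smul_eq_mul, pureTensor_apply,
    ← Finset.prod_erase_mul _ _ (Finset.mem_univ k), Function.update_self]
  congr 1
  refine Finset.prod_congr rfl fun l hl => ?_
  rw [Function.update_of_ne (Finset.ne_of_mem_erase hl), LinearMap.id_apply]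

/-- The sites other than `k` are absorbed into the ancilla, over which a cb bound is uniform. -/
theorem CbBound.siteMap {L : Matrix b b ℂ →ₗ[ℂ] Matrix b b ℂ} {C : ℝ} (h : CbBound L C)
    (k : Fin n) : CbBound (siteMap k L) C := by
  intro m A
  let e : (Fin n → b) × Fin m ≃ b × (({j // j ≠ k} → b) × Fin m) :=
    ((Equiv.funSplitAt k b).prodCongr (Equiv.refl (Fin m))).trans (Equiv.prodAssoc _ _ _)
  have h1 := h.norm_le (A.submatrix e.symm e.symm)
  rw [norm_submatrix_equiv, ← norm_submatrix_equiv e] at h1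
  refine le_trans (le_of_eq ?_) h1
  congr 1

/-- The map is a composition of one-site maps, and each site of `S` costs one factor `C`. -/
theorem CbBound.tensorMap_ite {L : Matrix b b ℂ →ₗ[ℂ] Matrix b b ℂ} {C : ℝ} (hC : 0 ≤ C)
    (h : CbBound L C) (S : Finset (Fin n)) :
    CbBound (tensorMap fun k => if k ∈ S then L else LinearMap.id) (C ^ S.card) := by
  induction S using Finset.induction_on with
  | empty =>
    simp only [Finset.notMem_empty, if_false, tensorMap_id, Finset.card_empty, pow_zero]
    exact cbBound_id
  | insert k S hk ih =>
    have h1 : (fun l => if l ∈ insert k S then L else LinearMap.id) = fun l =>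
        (Function.update (fun _ => LinearMap.id) k L : Fin n → _) l ∘ₗ
          (if l ∈ S then L else LinearMap.id) := by
      funext l
      by_cases hl : l = k
      · subst hl
        simp [hk]
      · simp [hl]
    rw [h1, tensorMap_comp, tensorMap_update_id, Finset.card_insert_of_notMem hk, pow_succ']
    exact (h.siteMap k).comp hC ih

end TensorMap

/-! ### Algebra of product operators. -/

section PureTensor

variable {n : ℕ} {a b c : Type*} [Fintype b] [DecidableEq b]

theorem pureTensor_conjTranspose (X : Fin n → Matrix a b ℂ) :
    (pureTensor X)ᴴ = pureTensor fun k => (X k)ᴴ := by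
  ext i j
  simp [pureTensor_apply, Matrix.conjTranspose_apply]

theorem pureTensor_mul (X : Fin n → Matrix a b ℂ) (Y : Fin n → Matrix b c ℂ) :
    pureTensor X * pureTensor Y = pureTensor fun k => X k * Y k := by
  ext i j
  simp only [pureTensor_apply, Matrix.mul_apply, ← Finset.prod_mul_distrib]
  rw [Finset.prod_univ_sum, Fintype.piFinset_univ]

end PureTensor

/-! ### Weyl operators as an error basis. -/

section Weyl

variable {F : Type*} [Field F] [Fintype F] [DecidableEq F] (χ : AddChar F ℂ) {n : ℕ}

/-- The Weyl operator `XᵃZᵇ` with `p = (a, b)`. -/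
def weyl (p : F × F) : Matrix F F ℂ :=
  Matrix.of fun s t => if s = t + p.1 then χ (p.2 * t) else 0

theorem weyl_apply (p : F × F) (s t : F) :
    weyl χ p s t = if s = t + p.1 then χ (p.2 * t) else 0 := rfl

theorem weyl_zero : weyl χ 0 = 1 := by
  ext s t
  simp [weyl_apply, Matrix.one_apply]

-- On each shifted diagonal `s - t = a` the Weyl operators are additive characters, so `β` is given
-- by Fourier inversion in the second coordinate.
variable {χ} in
theorem exists_eq_sum_weyl (hχ : χ.IsPrimitive) (X : Matrix F F ℂ) :
    ∃ β : F × F → ℂ, X = ∑ p, β p • weyl χ p := by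
  refine ⟨fun p => (Fintype.card F : ℂ)⁻¹ * ∑ t, X (t + p.1) t * χ (-(p.2 * t)), ?_⟩
  ext s t
  have hc : (Fintype.card F : ℂ) ≠ 0 := Nat.cast_ne_zero.2 Fintype.card_ne_zero
  have h : ∀ t', ∑ b, χ (-(b * t')) * χ (b * t) = if t - t' = 0 then (Fintype.card F : ℂ) else 0 := by
    intro t'
    have h0 := AddChar.sum_mulShift (t - t') hχ
    rw [Nat.cast_ite, Nat.cast_zero] at h0
    rw [← h0]
    refine Finset.sum_congr rfl fun b _ => ?_
    rw [← AddChar.map_add_eq_mul]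
    congr 1
    ring
  simp only [Matrix.sum_apply, Matrix.smul_apply, smul_eq_mul, Fintype.sum_prod_type, weyl_apply]
  rw [Finset.sum_eq_single (s - t)]
  · simp only [add_sub_cancel, if_true, Finset.mul_sum, Finset.sum_mul]
    rw [Finset.sum_comm, Finset.sum_eq_single t]
    · simp only [add_sub_cancel]
      have := h t
      simp only [sub_self, if_true] at this
      calc X s t = (Fintype.card F : ℂ)⁻¹ * X s t * ∑ b, χ (-(b * t)) * χ (b * t) := by
            rw [this]
            field_simp
        _ = _ := by
            rw [Finset.mul_sum]
            exact Finset.sum_congr rfl fun b _ => by ring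
    · intro t' _ ht'
      calc _ = (Fintype.card F : ℂ)⁻¹ * X (t' + (s - t)) t' * ∑ b, χ (-(b * t')) * χ (b * t) := by
            rw [Finset.mul_sum]
            exact Finset.sum_congr rfl fun b _ => by ring
        _ = 0 := by
            rw [h, if_neg (sub_ne_zero.2 ht'.symm), mul_zero]
    · simp
  · intro a _ ha
    refine Finset.sum_eq_zero fun b _ => ?_
    rw [if_neg, mul_zero]
    rintro rfl
    exact ha (by ring)
  · simp

-- Since `e_is* A e_jt = A i j • e_st`, every linear map is a combination of such sandwiches, whose
-- outer factors then expand in Weyl operators. Positivity plays no role, which matters because the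
-- lemma is applied to `T - id`.
variable {χ} in
theorem exists_weyl_expansion (hχ : χ.IsPrimitive) (L : Matrix F F ℂ →ₗ[ℂ] Matrix F F ℂ) :
    ∃ c : F × F → F × F → ℂ, ∀ A, L A = ∑ p, ∑ q, c p q • ((weyl χ p)ᴴ * A * weyl χ q) := by
  choose β hβ using exists_eq_sum_weyl hχ
  refine ⟨fun p q => ∑ i, ∑ j, ∑ s, ∑ t, L (Matrix.single i j 1) s t *
    star (β (Matrix.single i s 1) p) * β (Matrix.single j t 1) q, fun A => ?_⟩
  have h1 : ∀ i j s t, (Matrix.single i s (1 : ℂ))ᴴ * A * Matrix.single j t 1 =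
      ∑ p, ∑ q, (star (β (Matrix.single i s 1) p) * β (Matrix.single j t 1) q) •
        ((weyl χ p)ᴴ * A * weyl χ q) := by
    intro i j s t
    conv_lhs => rw [hβ (Matrix.single i s 1), hβ (Matrix.single j t 1)]
    simp only [Matrix.conjTranspose_sum, Matrix.conjTranspose_smul, Finset.sum_mul, Finset.mul_sum,
      Matrix.smul_mul, Matrix.mul_smul, smul_smul]
    rw [Finset.sum_comm]
    refine Finset.sum_congr rfl fun p _ => Finset.sum_congr rfl fun q _ => ?_
    rw [mul_comm]
  have h2 : L A = ∑ i, ∑ j, ∑ s, ∑ t, L (Matrix.single i j 1) s t •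
      ((Matrix.single i s (1 : ℂ))ᴴ * A * Matrix.single j t 1) := by
    ext s t
    rw [apply_eq_sum_single]
    simp only [Matrix.sum_apply, Matrix.smul_apply, smul_eq_mul]
    refine Finset.sum_congr rfl fun i _ => Finset.sum_congr rfl fun j _ => ?_
    rw [Finset.sum_eq_single s, Finset.sum_eq_single t]
    · rw [Matrix.conjTranspose_single, mul_comm]
      simp
    · intro t' _ ht'
      simp [Matrix.mul_single_apply_of_ne _ _ _ _ _ ht'.symm]
    · simp
    · intro s' _ hs'
      refine Finset.sum_eq_zero fun t' _ => ?_
      rw [Matrix.conjTranspose_single, Matrix.mul_assoc,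
        Matrix.single_mul_apply_of_ne _ _ _ _ _ hs'.symm, mul_zero]
    · simp
  rw [h2]
  simp_rw [h1, Finset.smul_sum, smul_smul, Finset.sum_smul]
  simp only [← mul_assoc]
  calc _ = ∑ x : (F × F) × (F × F), ∑ y : (F × F) × (F × F),
      (L (Matrix.single x.1.1 x.1.2 1) x.2.1 x.2.2 * star (β (Matrix.single x.1.1 x.2.1 1) y.1) *
        β (Matrix.single x.1.2 x.2.2 1) y.2) • ((weyl χ y.1)ᴴ * A * weyl χ y.2) := by
        simp only [Fintype.sum_prod_type]
    _ = _ := by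
        rw [Finset.sum_comm]
        simp only [Fintype.sum_prod_type]

/-- The product Weyl operator on `n` sites. -/
def weylTensor (x : Fin n → F × F) : Matrix (Fin n → F) (Fin n → F) ℂ :=
  pureTensor fun k => weyl χ (x k)

theorem weylTensor_zero : weylTensor χ (0 : Fin n → F × F) = 1 := by
  simp only [weylTensor, Pi.zero_apply, weyl_zero, pureTensor_one]

variable {χ} in
theorem tensorMap_eq_sum_weyl {L : Fin n → Matrix F F ℂ →ₗ[ℂ] Matrix F F ℂ}
    {c : Fin n → F × F → F × F → ℂ}
    (h : ∀ k A, L k A = ∑ p, ∑ q, c k p q • ((weyl χ p)ᴴ * A * weyl χ q))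
    (A : Matrix (Fin n → F) (Fin n → F) ℂ) :
    tensorMap L A = ∑ x, ∑ y, (∏ k, c k (x k) (y k)) •
      ((weylTensor χ x)ᴴ * A * weylTensor χ y) := by
  have key : tensorMap L = ∑ x : Fin n → F × F, ∑ y : Fin n → F × F, (∏ k, c k (x k) (y k)) •
      (LinearMap.mulRight ℂ (weylTensor χ y) ∘ₗ LinearMap.mulLeft ℂ (weylTensor χ x)ᴴ) := by
    refine ext_pureTensor fun X => ?_
    simp only [LinearMap.sum_apply, LinearMap.smul_apply, LinearMap.comp_apply,
      LinearMap.mulLeft_apply, LinearMap.mulRight_apply, tensorMap_pureTensor, weylTensor,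
      pureTensor_conjTranspose, pureTensor_mul, h]
    ext p q
    simp only [pureTensor_apply, Matrix.sum_apply, Matrix.smul_apply, smul_eq_mul,
      ← Finset.prod_mul_distrib]
    rw [sum_sum_prod]
  rw [key]
  simp only [LinearMap.sum_apply, LinearMap.smul_apply, LinearMap.comp_apply,
      LinearMap.mulLeft_apply, LinearMap.mulRight_apply]

end Weyl

/-! ### Pure codes and the coding error. -/

section Coding

variable {F : Type*} [Field F] [Fintype F] [DecidableEq F] {χ : AddChar F ℂ} {n : ℕ}

/-- The number of sites on which a product Weyl operator acts nontrivially. -/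
def weight (x : Fin n → F × F) : ℕ := (Finset.univ.filter fun k => x k ≠ 0).card

theorem weight_zero : weight (0 : Fin n → F × F) = 0 := by simp [weight]

theorem weight_le {x : Fin n → F × F} {S : Finset (Fin n)} (h : ∀ k ∉ S, x k = 0) :
    weight x ≤ S.card := by
  refine Finset.card_le_card fun k hk => ?_
  by_contra hkS
  exact (Finset.mem_filter.1 hk).2 (h k hkS)

/-- A pure quantum code: the product Weyl operators of weight at most `f` map the code space, the
range of the isometry `V`, to mutually orthogonal subspaces. -/
def IsPureCode (χ : AddChar F ℂ) (f : ℕ) {M : ℕ} (V : Matrix (Fin n → F) (Fin M) ℂ) : Prop :=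
  ∀ x y : Fin n → F × F, weight x ≤ f → weight y ≤ f →
    (weylTensor χ x * V)ᴴ * (weylTensor χ y * V) = if x = y then 1 else 0

/-- The projection onto the complement of the span of the images of the code space under the
correctable errors. -/
noncomputable def uncorrectable (χ : AddChar F ℂ) (f : ℕ) {M : ℕ}
    (V : Matrix (Fin n → F) (Fin M) ℂ) : Matrix (Fin n → F) (Fin n → F) ℂ :=
  1 - ∑ x : {x : Fin n → F × F // weight x ≤ f},
    (weylTensor χ x.1 * V) * (weylTensor χ x.1 * V)ᴴ

/-- Kraus operators of the decoder: undo the error, or replace the state by a fixed one. -/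
noncomputable def decoderKraus (χ : AddChar F ℂ) (f : ℕ) {M : ℕ}
    (V : Matrix (Fin n → F) (Fin M) ℂ) (i₀ : Fin M) :
    {x : Fin n → F × F // weight x ≤ f} ⊕ (Fin n → F) → Matrix (Fin M) (Fin n → F) ℂ
  | Sum.inl x => (weylTensor χ x.1 * V)ᴴ
  | Sum.inr y => Matrix.single i₀ y (1 : ℂ) * uncorrectable χ f V

namespace IsPureCode

variable {f M : ℕ} {V : Matrix (Fin n → F) (Fin M) ℂ}

theorem conjTranspose_mul_self (hV : IsPureCode χ f V) : Vᴴ * V = 1 := by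
  simpa [weylTensor_zero] using hV 0 0 (by simp [weight_zero]) (by simp [weight_zero])

theorem uncorrectable_mul (hV : IsPureCode χ f V) {y : Fin n → F × F} (hy : weight y ≤ f) :
    uncorrectable χ f V * (weylTensor χ y * V) = 0 := by
  rw [uncorrectable, Matrix.sub_mul, Matrix.one_mul, Matrix.sum_mul,
    Finset.sum_eq_single ⟨y, hy⟩]
  · rw [Matrix.mul_assoc, hV y y hy hy, if_pos rfl, Matrix.mul_one, sub_self]
  · intro x _ hxy
    rw [Matrix.mul_assoc, hV x.1 y x.2 hy, if_neg fun h => hxy (Subtype.ext h), Matrix.mul_zero]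
  · simp

/-- The images of the code space are orthogonal, so `uncorrectable` is a projection; it supplies
exactly what the recovery operators leave out of `1`. -/
theorem sum_decoderKraus (hV : IsPureCode χ f V) (i₀ : Fin M) :
    ∑ j, (decoderKraus χ f V i₀ j)ᴴ * decoderKraus χ f V i₀ j = 1 := by
  have hQ : (uncorrectable χ f V)ᴴ = uncorrectable χ f V := by
    simp [uncorrectable, Matrix.conjTranspose_sum]
  have hQQ : (uncorrectable χ f V)ᴴ * uncorrectable χ f V = uncorrectable χ f V := by
    rw [hQ]
    conv_lhs => rw [show uncorrectable χ f V * uncorrectable χ f V = uncorrectable χ f V *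
      (1 - ∑ x : {x : Fin n → F × F // weight x ≤ f},
        (weylTensor χ x.1 * V) * (weylTensor χ x.1 * V)ᴴ) from rfl]
    rw [Matrix.mul_sub, Matrix.mul_one, Matrix.mul_sum, Finset.sum_eq_zero, sub_zero]
    intro x _
    rw [← Matrix.mul_assoc, hV.uncorrectable_mul x.2, Matrix.zero_mul]
  have h1 : ∀ y : Fin n → F, (decoderKraus χ f V i₀ (Sum.inr y))ᴴ *
      decoderKraus χ f V i₀ (Sum.inr y) =
      (uncorrectable χ f V)ᴴ * (Matrix.single y y (1 : ℂ) * uncorrectable χ f V) := by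
    intro y
    simp only [decoderKraus, Matrix.conjTranspose_mul, Matrix.conjTranspose_single, star_one]
    rw [Matrix.mul_assoc, ← Matrix.mul_assoc (Matrix.single y i₀ (1 : ℂ)),
      Matrix.single_mul_single_same, one_mul]
  have h2 : ∑ y : Fin n → F, Matrix.single y y (1 : ℂ) = 1 := by
    ext p q
    simp only [Matrix.sum_apply, Matrix.single_apply, Matrix.one_apply]
    by_cases hpq : p = q
    · subst hpq
      simp
    · rw [if_neg hpq]
      refine Finset.sum_eq_zero fun y _ => if_neg ?_
      rintro ⟨rfl, rfl⟩
      exact hpq rfl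
  rw [Fintype.sum_sum_type]
  simp_rw [h1]
  rw [← Matrix.mul_sum, ← Matrix.sum_mul, h2, Matrix.one_mul, hQQ]
  simp [decoderKraus, uncorrectable]

theorem conjTranspose_mul_decoder_mul (hV : IsPureCode χ f V) (i₀ : Fin M)
    {x y : Fin n → F × F} (hx : weight x ≤ f) (hy : weight y ≤ f) (A : Matrix (Fin M) (Fin M) ℂ) :
    (weylTensor χ x * V)ᴴ * krausMap (decoderKraus χ f V i₀) A * (weylTensor χ y * V) =
      if x = y then A else 0 := by
  have h0 : ∀ j : Fin n → F, decoderKraus χ f V i₀ (Sum.inr j) * (weylTensor χ y * V) = 0 := by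
    intro j
    rw [decoderKraus, Matrix.mul_assoc, hV.uncorrectable_mul hy, Matrix.mul_zero]
  have h1 : ∀ j, (weylTensor χ x * V)ᴴ * ((decoderKraus χ f V i₀ j)ᴴ * A *
      decoderKraus χ f V i₀ j) * (weylTensor χ y * V) =
      (decoderKraus χ f V i₀ j * (weylTensor χ x * V))ᴴ * A *
        (decoderKraus χ f V i₀ j * (weylTensor χ y * V)) := by
    intro j
    simp only [Matrix.conjTranspose_mul, Matrix.mul_assoc]
  rw [krausMap_apply, Matrix.mul_sum, Matrix.sum_mul]
  simp_rw [h1]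
  rw [Fintype.sum_sum_type]
  simp only [h0, Matrix.mul_zero, Finset.sum_const_zero, add_zero]
  rw [Finset.sum_eq_single ⟨y, hy⟩]
  · simp only [decoderKraus]
    rw [hV y x hy hx, hV y y hy hy, if_pos rfl, Matrix.mul_one]
    by_cases hxy : x = y
    · simp [hxy]
    · simp [hxy, Ne.symm hxy]
  · intro z _ hzy
    simp only [decoderKraus]
    rw [hV z.1 y z.2 hy, if_neg fun h => hzy (Subtype.ext h), Matrix.mul_zero]
  · simp

/-- Only Weyl pairs supported in `S` occur, and for these the recovered operator is `A` on the
diagonal `x = y` and `0` off it. The scalar collects the diagonal coefficients. -/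
theorem exists_encoder_comp_decoder (hχ : χ.IsPrimitive) (hV : IsPureCode χ f V) (i₀ : Fin M)
    (L : Matrix F F ℂ →ₗ[ℂ] Matrix F F ℂ) {S : Finset (Fin n)} (hS : S.card ≤ f) :
    ∃ μ : ℂ, ∀ A, krausMap (fun _ : Unit => V)
      (tensorMap (fun k => if k ∈ S then L else LinearMap.id)
        (krausMap (decoderKraus χ f V i₀) A)) = μ • A := by
  obtain ⟨c, hc⟩ := exists_weyl_expansion hχ L
  -- Off `S` the identity map is expanded by the single pair `(0, 0)`, as `weyl χ 0 = 1`; this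
  -- confines the surviving errors to `S`.
  let c' : Fin n → F × F → F × F → ℂ := fun k p q =>
    if k ∈ S then c p q else if p = 0 ∧ q = 0 then 1 else 0
  have hc' : ∀ k A, (if k ∈ S then L else LinearMap.id) A =
      ∑ p, ∑ q, c' k p q • ((weyl χ p)ᴴ * A * weyl χ q) := by
    intro k A
    by_cases hk : k ∈ S
    · simp only [c', hk, if_true, hc]
    · simp only [c', hk, if_false]
      rw [Finset.sum_eq_single 0, Finset.sum_eq_single 0]
      · simp [weyl_zero]
      · intro q _ hq
        simp [hq]
      · simp
      · intro p _ hp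
        simp [hp]
      · simp
  have hzero : ∀ x y : Fin n → F × F, ∏ k, c' k (x k) (y k) ≠ 0 → weight x ≤ f ∧ weight y ≤ f := by
    intro x y hxy
    have h : ∀ k ∉ S, x k = 0 ∧ y k = 0 := by
      intro k hk
      by_contra hne
      refine hxy (Finset.prod_eq_zero (Finset.mem_univ k) ?_)
      simp only [c', hk, if_false, hne]
    exact ⟨(weight_le fun k hk => (h k hk).1).trans hS, (weight_le fun k hk => (h k hk).2).trans hS⟩
  refine ⟨∑ x : Fin n → F × F, ∑ y, (∏ k, c' k (x k) (y k)) * if x = y then 1 else 0, fun A => ?_⟩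
  rw [tensorMap_eq_sum_weyl hc', krausMap_apply]
  simp only [Finset.univ_unique, Finset.sum_singleton, Matrix.mul_sum, Matrix.sum_mul,
    Finset.sum_smul, Matrix.mul_smul, Matrix.smul_mul]
  refine Finset.sum_congr rfl fun x _ => Finset.sum_congr rfl fun y _ => ?_
  by_cases hxy : ∏ k, c' k (x k) (y k) = 0
  · simp [hxy]
  · obtain ⟨hx, hy⟩ := hzero x y hxy
    have h := hV.conjTranspose_mul_decoder_mul i₀ hx hy A
    rw [Matrix.conjTranspose_mul] at h
    rw [mul_smul, ite_smul, one_smul, zero_smul, ← h]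
    simp only [Matrix.mul_assoc]

theorem codingError_le (hχ : χ.IsPrimitive) (hV : IsPureCode χ f V) (hM : 0 < M)
    {T : Matrix F F ℂ →ₗ[ℂ] Matrix F F ℂ} (hT : T 1 = 1) {C : ℝ} (hC : 0 ≤ C)
    (hTC : CbBound (T - LinearMap.id) C) :
    codingError (tensorPower T n) M ≤ ENNReal.ofReal
      (∑ S ∈ Finset.univ.filter fun S : Finset (Fin n) => f < S.card, C ^ S.card) := by
  let i₀ : Fin M := ⟨0, hM⟩
  let E := krausMap (fun _ : Unit => V)
  let D := krausMap (decoderKraus χ f V i₀)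
  let L : Finset (Fin n) → Matrix (Fin n → F) (Fin n → F) ℂ →ₗ[ℂ] Matrix (Fin n → F) (Fin n → F) ℂ :=
    fun S => tensorMap fun k => if k ∈ S then T - LinearMap.id else LinearMap.id
  have hEK : ∑ _j : Unit, Vᴴ * V = 1 := by simp [hV.conjTranspose_mul_self]
  have hDK := hV.sum_decoderKraus i₀
  have hE : IsChannel E := isChannel_krausMap _ hEK
  have hD : IsChannel D := isChannel_krausMap _ hDK
  have hT' : tensorPower T n = ∑ S, L S := by
    rw [tensorPower_eq_tensorMap, ← tensorMap_add]
    congr 1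
    funext k
    simp
  have hlow : ∀ S : Finset (Fin n), S.card ≤ f →
      E ∘ₗ L S ∘ₗ D = if S = ∅ then LinearMap.id else 0 := by
    intro S hS
    obtain ⟨μ, hμ⟩ := hV.exists_encoder_comp_decoder hχ i₀ (T - LinearMap.id) hS
    have h1 : E (L S (D 1)) = if S = ∅ then 1 else 0 := by
      rw [hD.unital]
      split_ifs with h
      · subst h
        simp only [L, Finset.notMem_empty, if_false, tensorMap_id, LinearMap.id_apply, hE.unital]
      · obtain ⟨k, hk⟩ := Finset.nonempty_iff_ne_empty.2 h
        have : L S 1 = 0 := by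
          rw [← pureTensor_one, tensorMap_pureTensor]
          ext p q
          rw [pureTensor_apply]
          refine Finset.prod_eq_zero (Finset.mem_univ k) ?_
          simp [hk, hT]
        rw [this, map_zero]
    -- The scalar is read off at the entry `(i₀, i₀)` of `μ • 1`, which exists because `M > 0`.
    have h2 : μ = if S = ∅ then 1 else 0 := by
      have := congrFun (congrFun ((hμ 1).symm.trans h1) i₀) i₀
      split_ifs at this ⊢ <;> simpa using this
    refine LinearMap.ext fun A => (hμ A).trans ?_
    rw [h2]
    split_ifs <;> simp
  have hdiff : E ∘ₗ tensorPower T n ∘ₗ D - LinearMap.id =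
      ∑ S ∈ Finset.univ.filter fun S : Finset (Fin n) => f < S.card, E ∘ₗ L S ∘ₗ D := by
    have h1 : E ∘ₗ tensorPower T n ∘ₗ D = ∑ S, E ∘ₗ L S ∘ₗ D := by
      rw [hT']
      ext1 A
      simp [LinearMap.sum_apply]
    have h2 : ∑ S ∈ Finset.univ.filter (fun S : Finset (Fin n) => ¬ f < S.card),
        E ∘ₗ L S ∘ₗ D = LinearMap.id := by
      rw [Finset.sum_congr rfl fun S hS => hlow S (not_lt.1 (Finset.mem_filter.1 hS).2)]
      rw [Finset.sum_ite_eq' _ ∅ fun _ => LinearMap.id]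
      simp
    rw [h1, ← Finset.sum_filter_add_sum_filter_not _ fun S : Finset (Fin n) => f < S.card, h2,
      add_sub_cancel_right]
  refine (iInf_le_of_le E (iInf_le_of_le D (iInf_le_of_le hE (iInf_le_of_le hD le_rfl)))).trans ?_
  rw [hdiff]
  refine CbBound.cbNorm_le (Finset.sum_nonneg fun S _ => pow_nonneg hC _) (CbBound.sum fun S _ => ?_)
  have h1 := (cbBound_krausMap _ hEK).comp zero_le_one
    ((hTC.tensorMap_ite hC S).comp (pow_nonneg hC _) (cbBound_krausMap _ hDK))
  rwa [one_mul, mul_one] at h1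

end IsPureCode

end Coding

/-! ### Graph codes and character sums. -/

section GraphCode

variable {F : Type*} [Field F] [Fintype F] [DecidableEq F] {χ : AddChar F ℂ} {n k M : ℕ}

theorem addChar_sum_eq_prod {ι : Type*} (s : Finset ι) (g : ι → F) :
    χ (∑ i ∈ s, g i) = ∏ i ∈ s, χ (g i) := by
  classical
  induction s using Finset.induction_on with
  | empty => simp
  | insert i s hi ih => rw [Finset.sum_insert hi, Finset.prod_insert hi, AddChar.map_add_eq_mul, ih]

theorem sum_char_dotProduct (hχ : χ.IsPrimitive) (c : Fin n → F) :
    ∑ s : Fin n → F, χ (s ⬝ᵥ c) = if c = 0 then (Fintype.card F : ℂ) ^ n else 0 := by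
  have h : ∀ s : Fin n → F, χ (s ⬝ᵥ c) = ∏ l, χ (s l * c l) := fun s => by
    rw [dotProduct, addChar_sum_eq_prod]
  have h2 : ∀ l, ∑ t, χ (t * c l) = if c l = 0 then (Fintype.card F : ℂ) else 0 := fun l => by
    rw [AddChar.sum_mulShift (c l) hχ, Nat.cast_ite, Nat.cast_zero]
  simp_rw [h]
  rw [← Fintype.piFinset_univ, ← Finset.prod_univ_sum (fun _ => Finset.univ)
    (fun l t => χ (t * c l))]
  simp_rw [h2]
  rw [Finset.prod_ite_zero]
  simp [funext_iff]

theorem weylTensor_apply (x : Fin n → F × F) (s t : Fin n → F) :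
    weylTensor χ x s t =
      if s = t + (fun l => (x l).1) then χ ((fun l => (x l).2) ⬝ᵥ t) else 0 := by
  simp only [weylTensor, pureTensor_apply, weyl_apply]
  rw [Finset.prod_ite_zero, dotProduct, addChar_sum_eq_prod]
  simp [funext_iff]

/-- The quadratic phase defining a graph code. -/
def graphPhase (G : Matrix (Fin n) (Fin n) F) (B : Matrix (Fin n) (Fin k) F) (y : Fin n → F)
    (w : Fin k → F) : F :=
  y ⬝ᵥ G *ᵥ y + y ⬝ᵥ B *ᵥ w

/-- The isometry of a graph code, restricted to the inputs `u i`. -/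
noncomputable def graphIsometry (χ : AddChar F ℂ) (G : Matrix (Fin n) (Fin n) F)
    (B : Matrix (Fin n) (Fin k) F) (u : Fin M → Fin k → F) : Matrix (Fin n → F) (Fin M) ℂ :=
  Matrix.of fun y i =>
    (((Real.sqrt ((Fintype.card F : ℝ) ^ n))⁻¹ : ℝ) : ℂ) * χ (graphPhase G B y (u i))

theorem weylTensor_mul_apply (x : Fin n → F × F) (V : Matrix (Fin n → F) (Fin M) ℂ)
    (s : Fin n → F) (i : Fin M) :
    (weylTensor χ x * V) s i = χ ((fun l => (x l).2) ⬝ᵥ (s - fun l => (x l).1)) *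
      V (s - fun l => (x l).1) i := by
  rw [Matrix.mul_apply, Finset.sum_eq_single (s - fun l => (x l).1)]
  · simp [weylTensor_apply]
  · intro t _ ht
    rw [weylTensor_apply, if_neg, zero_mul]
    rintro rfl
    simp at ht
  · simp

/-- Both shifted phases contain the same quadratic form in `s`, which cancels. The exponent of the
inner product is thus affine in `s`, ready for character orthogonality. -/
theorem graphPhase_sub (G : Matrix (Fin n) (Fin n) F) (B : Matrix (Fin n) (Fin k) F)
    (a a' b b' s : Fin n → F) (w w' : Fin k → F) :
    -(b ⬝ᵥ (s - a) + graphPhase G B (s - a) w) + (b' ⬝ᵥ (s - a') + graphPhase G B (s - a') w') =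
      s ⬝ᵥ (b' - b + ((G + Gᵀ) *ᵥ (a - a') + B *ᵥ (w' - w))) +
        (-(b ⬝ᵥ (-a) + graphPhase G B (-a) w) + (b' ⬝ᵥ (-a') + graphPhase G B (-a') w')) := by
  have hG : ∀ v : Fin n → F, s ⬝ᵥ Gᵀ *ᵥ v = v ⬝ᵥ G *ᵥ s := fun v => by
    rw [Matrix.mulVec_transpose, dotProduct_comm, Matrix.dotProduct_mulVec]
  simp only [graphPhase, Matrix.mulVec_sub, Matrix.mulVec_neg, Matrix.add_mulVec, sub_dotProduct,
    dotProduct_sub, dotProduct_add, neg_dotProduct, dotProduct_neg, hG]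
  rw [dotProduct_comm b s, dotProduct_comm b' s]
  ring

/-- The error-correction condition on a graph: deleting any `r` vertices leaves the remaining
adjacency matrix injective. -/
def DetectsErrors (r : ℕ) (G : Matrix (Fin n) (Fin n) F) (B : Matrix (Fin n) (Fin k) F) : Prop :=
  ∀ (R : Finset (Fin n)), R.card ≤ r → ∀ (z : Fin n → F) (w : Fin k → F), (∀ i ∉ R, z i = 0) →
    (∀ j ∉ R, ((G + Gᵀ) *ᵥ z + B *ᵥ w) j = 0) → z = 0 ∧ w = 0

/-- The inner product of two shifted code vectors is a character sum, which vanishes unless its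
linear coefficient `c` is zero. -/
theorem DetectsErrors.isPureCode (hχ : χ.IsPrimitive) {f : ℕ} {G : Matrix (Fin n) (Fin n) F}
    {B : Matrix (Fin n) (Fin k) F} (h : DetectsErrors (2 * f) G B) {u : Fin M → Fin k → F}
    (hu : Function.Injective u) : IsPureCode χ f (graphIsometry χ G B u) := by
  intro x y hx hy
  ext i j
  set γ : ℝ := (Real.sqrt ((Fintype.card F : ℝ) ^ n))⁻¹ with hγ
  have hγ2 : (γ : ℂ) * γ * (Fintype.card F : ℂ) ^ n = 1 := by
    have h0 : (0 : ℝ) < (Fintype.card F : ℝ) ^ n := by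
      have : (0 : ℝ) < Fintype.card F := Nat.cast_pos.2 Fintype.card_pos
      positivity
    have h1 : γ * γ * (Fintype.card F : ℝ) ^ n = 1 := by
      rw [hγ, ← mul_inv, Real.mul_self_sqrt h0.le, inv_mul_cancel₀ h0.ne']
    exact_mod_cast h1
  let a := fun l => (x l).1
  let b := fun l => (x l).2
  let a' := fun l => (y l).1
  let b' := fun l => (y l).2
  let c := b' - b + ((G + Gᵀ) *ᵥ (a - a') + B *ᵥ (u j - u i))
  let e := -(b ⬝ᵥ (-a) + graphPhase G B (-a) (u i)) + (b' ⬝ᵥ (-a') + graphPhase G B (-a') (u j))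
  have hsum : ((weylTensor χ x * graphIsometry χ G B u)ᴴ *
      (weylTensor χ y * graphIsometry χ G B u)) i j =
      γ * γ * χ e * if c = 0 then (Fintype.card F : ℂ) ^ n else 0 := by
    rw [← sum_char_dotProduct hχ c, Finset.mul_sum, Matrix.mul_apply]
    refine Finset.sum_congr rfl fun s _ => ?_
    have h1 := congrArg χ (graphPhase_sub G B a a' b b' s (u i) (u j))
    rw [AddChar.map_add_eq_mul, AddChar.map_add_eq_mul _ (s ⬝ᵥ _), AddChar.map_neg_eq_conj,
      AddChar.map_add_eq_mul, AddChar.map_add_eq_mul, map_mul] at h1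
    simp only [Matrix.conjTranspose_apply, weylTensor_mul_apply, graphIsometry, Matrix.of_apply,
      ← hγ, star_mul', Complex.star_def, Complex.conj_ofReal]
    linear_combination (γ * γ : ℂ) * h1
  rw [hsum]
  by_cases hxy : x = y ∧ i = j
  · obtain ⟨rfl, rfl⟩ := hxy
    have hc : c = 0 := by simp [c, a, a', b, b']
    have he : e = 0 := by simp [e, a, a', b, b']
    simp [hc, he, hγ2]
  · have hc : c ≠ 0 := by
      intro hc
      refine hxy ?_
      -- Two errors of weight at most `f` together touch at most `2f` sites. Outside `R` the phases
      -- `b`, `b'` vanish, so `c = 0` becomes the kernel equation of `DetectsErrors`.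
      let R : Finset (Fin n) := (Finset.univ.filter fun l => x l ≠ 0) ∪
        Finset.univ.filter fun l => y l ≠ 0
      have hR : R.card ≤ 2 * f := by
        refine (Finset.card_union_le _ _).trans ?_
        rw [two_mul]
        exact add_le_add hx hy
      have hR' : ∀ l ∉ R, x l = 0 ∧ y l = 0 := by
        intro l hl
        simpa [R, not_or] using hl
      obtain ⟨hz, hw⟩ := h R hR (a - a') (u j - u i)
        (fun l hl => by simp [a, a', hR' l hl]) (fun l hl => by
          have := congrFun hc l
          simpa [c, b, b', hR' l hl] using this)
      have hij : i = j := (hu (sub_eq_zero.1 hw)).symm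
      have hb : b' - b = 0 := by
        have := hc
        simpa only [c, hz, hw, Matrix.mulVec_zero, add_zero] using this
      refine ⟨funext fun l => Prod.ext ?_ ?_, hij⟩
      · exact congrFun (sub_eq_zero.1 hz) l
      · exact (congrFun (sub_eq_zero.1 hb) l).symm
    rw [if_neg hc, mul_zero]
    by_cases hxy' : x = y
    · have hij : i ≠ j := fun hij => hxy ⟨hxy', hij⟩
      simp [hxy', Matrix.one_apply_ne hij]
    · simp [hxy']

end GraphCode

/-! ### Existence of good graphs by counting. -/

section Counting

variable {F : Type*} [Field F] [Fintype F] [DecidableEq F] {n k : ℕ}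

theorem exists_graph_eq {R : Finset (Fin n)} {z : Fin n → F} {w : Fin k → F}
    (hz : ∀ i ∉ R, z i = 0) (hzw : ¬(z = 0 ∧ w = 0)) (t : Fin n → F) :
    ∃ x : Matrix (Fin n) (Fin n) F × Matrix (Fin n) (Fin k) F,
      ∀ j ∉ R, ((x.1 + x.1ᵀ) *ᵥ z + x.2 *ᵥ w) j = t j := by
  by_cases hz0 : z = 0
  · have hw0 : w ≠ 0 := fun hw0 => hzw ⟨hz0, hw0⟩
    obtain ⟨l, hl⟩ := Function.ne_iff.1 hw0
    refine ⟨(0, Matrix.of fun j l' => if l' = l then t j / w l else 0), fun j _ => ?_⟩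
    have hl' : w l ≠ 0 := hl
    simp [Matrix.mulVec, dotProduct, hl']
  · obtain ⟨i, hi⟩ := Function.ne_iff.1 hz0
    have hi' : z i ≠ 0 := hi
    have hiR : i ∈ R := by
      by_contra h
      exact hi' (hz i h)
    -- Only column `i ∈ R` of `G` is used; its transpose then contributes only to row `i`, which is
    -- not among the rows prescribed.
    refine ⟨(Matrix.of fun j l => if l = i then (if j ∈ R then 0 else t j / z i) else 0, 0),
      fun j hj => ?_⟩
    have hji : j ≠ i := fun h => hj (h ▸ hiR)
    simp [Matrix.mulVec, dotProduct, hi', hj, hji]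

/-- The values off `R` depend additively on `(G, B)` and are arbitrary, so the kernel has index
`q^(n - |R|)`. Translating it by the preimages `σ t` gives disjoint copies. -/
theorem card_graph_kernel_mul_le {R : Finset (Fin n)} {z : Fin n → F} {w : Fin k → F}
    (hz : ∀ i ∉ R, z i = 0) (hzw : ¬(z = 0 ∧ w = 0)) :
    (Finset.univ.filter fun x : Matrix (Fin n) (Fin n) F × Matrix (Fin n) (Fin k) F =>
      ∀ j ∉ R, ((x.1 + x.1ᵀ) *ᵥ z + x.2 *ᵥ w) j = 0).card * Fintype.card F ^ (n - R.card) ≤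
      Fintype.card (Matrix (Fin n) (Fin n) F × Matrix (Fin n) (Fin k) F) := by
  choose σ hσ using exists_graph_eq (F := F) (k := k) hz hzw
  let T : Finset (Fin n → F) := Fintype.piFinset fun i => if i ∈ R then {0} else Finset.univ
  have hT : T.card = Fintype.card F ^ (n - R.card) := by
    rw [Fintype.card_piFinset]
    have : ∀ i, (if i ∈ R then ({0} : Finset F) else Finset.univ).card =
        if i ∈ R then 1 else Fintype.card F := by
      intro i
      split_ifs <;> simp
    simp_rw [this]
    rw [Finset.prod_ite, Finset.prod_const_one, one_mul, Finset.prod_const,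
      Finset.filter_not, Finset.filter_mem_eq_inter, Finset.univ_inter,
      ← Finset.compl_eq_univ_sdiff, Finset.card_compl, Fintype.card_fin]
  rw [← hT, ← Finset.card_product, ← Finset.card_univ]
  refine Finset.card_le_card_of_injOn (fun p => p.1 + σ p.2) (fun _ _ => Finset.mem_univ _) ?_
  rintro ⟨x, t⟩ hxt ⟨y, s⟩ hys hxy
  simp only [Finset.coe_product, Set.mem_prod, Finset.mem_coe, Finset.mem_filter, Finset.mem_univ,
    true_and, T, Fintype.mem_piFinset] at hxt hys
  have hval : ∀ (x : Matrix (Fin n) (Fin n) F × Matrix (Fin n) (Fin k) F) (t : Fin n → F),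
      (∀ j ∉ R, ((x.1 + x.1ᵀ) *ᵥ z + x.2 *ᵥ w) j = 0) → ∀ j ∉ R,
      (((x + σ t).1 + (x + σ t).1ᵀ) *ᵥ z + (x + σ t).2 *ᵥ w) j = t j := by
    intro x t hx j hj
    have h1 := hx j hj
    have h2 := hσ t j hj
    simp only [Prod.fst_add, Prod.snd_add, Matrix.transpose_add, Matrix.add_mulVec,
      Pi.add_apply] at h1 h2 ⊢
    linear_combination h1 + h2
  have hts : t = s := by
    funext j
    by_cases hj : j ∈ R
    · have h1 := hxt.2 j
      have h2 := hys.2 j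
      simp only [hj, if_true, Finset.mem_singleton] at h1 h2
      rw [h1, h2]
    · rw [← hval x t hxt.1 j hj, ← hval y s hys.1 j hj]
      have hxy' : x + σ t = y + σ s := hxy
      rw [hxy']
  subst hts
  have hxy' : x + σ t = y + σ t := hxy
  rw [add_right_cancel hxy']

/-- Union bound: there are `C(n, r)` sets `R`, at most `q^(r+k)` vectors `(z, w)` for each, and each
vector is killed by at most a fraction `q^(-(n-r))` of all pairs. -/
theorem exists_detectsErrors {r : ℕ} (hr : r ≤ n)
    (h : n.choose r * Fintype.card F ^ (2 * r + k) < Fintype.card F ^ n) :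
    ∃ (G : Matrix (Fin n) (Fin n) F) (B : Matrix (Fin n) (Fin k) F), DetectsErrors r G B := by
  classical
  by_contra hno
  push Not at hno
  set q := Fintype.card F with hq
  have hq0 : 0 < q := Fintype.card_pos
  let Ω := Matrix (Fin n) (Fin n) F × Matrix (Fin n) (Fin k) F
  let Ker : Finset (Fin n) → (Fin n → F) × (Fin k → F) → Finset Ω := fun R p =>
    Finset.univ.filter fun x => ∀ j ∉ R, ((x.1 + x.1ᵀ) *ᵥ p.1 + x.2 *ᵥ p.2) j = 0
  let Z : Finset (Fin n) → Finset ((Fin n → F) × (Fin k → F)) := fun R =>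
    ((Fintype.piFinset fun i => if i ∈ R then Finset.univ else {0}) ×ˢ Finset.univ).filter
      fun p => ¬(p.1 = 0 ∧ p.2 = 0)
  set m := Fintype.card Ω / q ^ (n - r) with hm
  have hZ : ∀ R ∈ Finset.powersetCard r (Finset.univ : Finset (Fin n)),
      (Z R).card ≤ q ^ (r + k) := by
    intro R hR
    refine (Finset.card_filter_le _ _).trans (le_of_eq ?_)
    rw [Finset.card_product, Fintype.card_piFinset]
    have : ∀ i, (if i ∈ R then Finset.univ else ({0} : Finset F)).card =
        if i ∈ R then q else 1 := by
      intro i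
      split_ifs
      · exact Finset.card_univ
      · simp
    simp_rw [this]
    rw [Finset.prod_ite, Finset.prod_const_one, mul_one, Finset.prod_const,
      Finset.filter_mem_eq_inter, Finset.univ_inter, (Finset.mem_powersetCard.1 hR).2, pow_add]
    simp [hq]
  have hKer : ∀ R ∈ Finset.powersetCard r (Finset.univ : Finset (Fin n)), ∀ p ∈ Z R,
      (Ker R p).card ≤ m := by
    intro R hR p hp
    rw [hm, Nat.le_div_iff_mul_le (pow_pos hq0 _), ← (Finset.mem_powersetCard.1 hR).2]
    obtain ⟨hp1, hp2⟩ := Finset.mem_filter.1 hp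
    refine card_graph_kernel_mul_le (fun i hi => ?_) hp2
    have := Fintype.mem_piFinset.1 (Finset.mem_product.1 hp1).1 i
    simpa [hi] using this
  have hcover : (Finset.univ : Finset Ω) ⊆
      (Finset.powersetCard r Finset.univ).biUnion fun R => (Z R).biUnion (Ker R) := by
    rintro ⟨G, B⟩ -
    have h1 := hno G B
    unfold DetectsErrors at h1
    push Not at h1
    obtain ⟨R, hR, z, w, hz, hker, hzw⟩ := h1
    -- Enlarging `R` preserves a counterexample, so sets of size exactly `r` suffice.
    obtain ⟨R', hRR', hR'⟩ := Finset.exists_superset_card_eq hR (by simpa using hr)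
    simp only [Finset.mem_biUnion]
    refine ⟨R', Finset.mem_powersetCard.2 ⟨Finset.subset_univ _, hR'⟩, (z, w), ?_, ?_⟩
    · refine Finset.mem_filter.2 ⟨Finset.mem_product.2 ⟨Fintype.mem_piFinset.2 fun i => ?_,
        Finset.mem_univ _⟩, fun hh => hzw hh.1 hh.2⟩
      by_cases hi : i ∈ R'
      · simp [hi]
      · simp [hi, hz i fun hh => hi (hRR' hh)]
    · exact Finset.mem_filter.2 ⟨Finset.mem_univ _, fun j hj => hker j fun hh => hj (hRR' hh)⟩
  have hcard := Finset.card_le_card hcover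
  have hle := hcard.trans (Finset.card_biUnion_le_card_mul _ _ (q ^ (r + k) * m) fun R hR =>
    (Finset.card_biUnion_le_card_mul _ _ m (hKer R hR)).trans (Nat.mul_le_mul_right _ (hZ R hR)))
  rw [Finset.card_powersetCard, Finset.card_univ, Finset.card_univ, Fintype.card_fin,
    ← mul_assoc] at hle
  have hΩ : 0 < Fintype.card Ω := Fintype.card_pos
  -- The truncated quotient `m` is nonzero, as otherwise the covering would make `Ω` empty;
  -- strictness below needs this.
  have hm0 : 0 < m := by
    rcases Nat.eq_zero_or_pos m with h0 | h0
    · rw [h0, mul_zero] at hle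
      omega
    · exact h0
  have hlt : n.choose r * q ^ (r + k) < q ^ (n - r) := by
    have h1 : q ^ n = q ^ r * q ^ (n - r) := by rw [← pow_add, Nat.add_sub_cancel' hr]
    have h2 : q ^ (2 * r + k) = q ^ r * q ^ (r + k) := by rw [← pow_add]; congr 1; ring
    rw [h1, h2, mul_left_comm] at h
    exact lt_of_mul_lt_mul_left h (Nat.zero_le _)
  have h3 : n.choose r * q ^ (r + k) * m < q ^ (n - r) * m := Nat.mul_lt_mul_of_pos_right hlt hm0
  have h4 : q ^ (n - r) * m ≤ Fintype.card Ω := Nat.mul_div_le _ _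
  omega

end Counting

/-! ### Entropy bounds for binomial sums. -/

section Entropy

theorem shannonEntropy_eq (r : ℝ) : shannonEntropy r = Real.binEntropy r / Real.log 2 := by
  simp only [shannonEntropy, Real.binEntropy, Real.logb, Real.log_inv]
  ring

/-- One term of `(x + (1 - x))^n = 1` is at most `1`; as `x ≤ 1 - x`, lowering `r` below `xn` only
increases `x^r (1-x)^(n-r)`. -/
theorem choose_le_exp_binEntropy {n r : ℕ} (hrn : r ≤ n) {x : ℝ} (hx0 : 0 < x) (hx : x ≤ 1 / 2)
    (hr : (r : ℝ) ≤ x * n) : (n.choose r : ℝ) ≤ Real.exp (n * Real.binEntropy x) := by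
  have hx1 : 0 < 1 - x := by linarith
  have h1 : x ^ r * (1 - x) ^ (n - r) * n.choose r ≤ 1 := by
    have h := Finset.single_le_sum (f := fun m => x ^ m * (1 - x) ^ (n - m) * (n.choose m : ℝ))
      (s := Finset.range (n + 1)) (fun m _ => by positivity)
      (Finset.mem_range.2 (Nat.lt_succ_of_le hrn))
    rw [← add_pow] at h
    simpa using h
  have h2 : Real.exp (-(n * Real.binEntropy x)) ≤ x ^ r * (1 - x) ^ (n - r) := by
    have hpow : ∀ (y : ℝ) (m : ℕ), 0 < y → y ^ m = Real.exp (m * Real.log y) := by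
      intro y m hy
      rw [Real.exp_nat_mul, Real.exp_log hy]
    rw [hpow x r hx0, hpow (1 - x) _ hx1, ← Real.exp_add, Real.exp_le_exp, Nat.cast_sub hrn]
    have hlog : Real.log x ≤ Real.log (1 - x) := Real.log_le_log hx0 (by linarith)
    simp only [Real.binEntropy, Real.log_inv]
    nlinarith [mul_nonneg (sub_nonneg.2 hr) (sub_nonneg.2 hlog)]
  have h3 := (mul_le_mul_of_nonneg_right h2 (Nat.cast_nonneg (n.choose r))).trans h1
  rwa [Real.exp_neg, inv_mul_le_iff₀ (Real.exp_pos _), mul_one] at h3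

/-- Chernoff tilting: the hypothesis forces `δ ≤ ε / (1 - ε)`, so replacing `δ` by that ratio costs
at most a factor with exponent `εn`. The tilted sum over all subsets is `(1 - ε)^(-n)`. -/
theorem sum_pow_card_le {n : ℕ} {ε δ : ℝ} (hε0 : 0 < ε) (hε : ε < 1 / 2) (hδ0 : 0 < δ)
    (hδ : ε * Real.log δ < -Real.binEntropy ε) :
    ∑ S ∈ Finset.univ.filter (fun S : Finset (Fin n) => ⌊ε * n⌋₊ < S.card), δ ^ S.card ≤
      Real.exp (n * (ε * Real.log δ + Real.binEntropy ε)) := by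
  have hε1 : 0 < 1 - ε := by linarith
  have hlog1 : Real.log (1 - ε) ≤ 0 := Real.log_nonpos hε1.le (by linarith)
  have hent : Real.binEntropy ε = -(ε * Real.log ε) - (1 - ε) * Real.log (1 - ε) := by
    simp only [Real.binEntropy, Real.log_inv]
    ring
  have hld : Real.log δ ≤ Real.log ε - Real.log (1 - ε) := by
    rw [hent] at hδ
    have h1 : ε * Real.log δ ≤ ε * (Real.log ε - Real.log (1 - ε)) := by nlinarith
    exact le_of_mul_le_mul_left h1 hε0
  have hterm : ∀ S ∈ Finset.univ.filter (fun S : Finset (Fin n) => ⌊ε * n⌋₊ < S.card),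
      δ ^ S.card ≤ Real.exp (ε * n * (Real.log δ - Real.log ε + Real.log (1 - ε))) *
        (ε / (1 - ε)) ^ S.card := by
    intro S hS
    have hS' : ε * n ≤ S.card := (Nat.lt_of_floor_lt (Finset.mem_filter.1 hS).2).le
    have hx : ε / (1 - ε) = Real.exp (Real.log ε - Real.log (1 - ε)) := by
      rw [Real.exp_sub, Real.exp_log hε0, Real.exp_log hε1]
    rw [hx, ← Real.exp_nat_mul, ← Real.exp_add]
    conv_lhs => rw [← Real.exp_log hδ0]
    rw [← Real.exp_nat_mul, Real.exp_le_exp]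
    nlinarith [mul_nonneg (sub_nonneg.2 hS') (sub_nonneg.2 hld)]
  refine (Finset.sum_le_sum hterm).trans ?_
  rw [← Finset.mul_sum]
  have hsum : ∑ S ∈ Finset.univ.filter (fun S : Finset (Fin n) => ⌊ε * n⌋₊ < S.card),
      (ε / (1 - ε)) ^ S.card ≤ Real.exp (-(n * Real.log (1 - ε))) := by
    have hx : 0 ≤ ε / (1 - ε) := (div_pos hε0 hε1).le
    refine (Finset.sum_le_univ_sum_of_nonneg fun S => pow_nonneg hx _).trans (le_of_eq ?_)
    have h := Fintype.sum_pow_mul_eq_add_pow (Fin n) (ε / (1 - ε)) 1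
    simp only [one_pow, mul_one, Fintype.card_fin] at h
    have h' : ε / (1 - ε) + 1 = (1 - ε)⁻¹ := by
      field_simp
      ring
    rw [h, h', inv_pow, Real.exp_neg, Real.exp_nat_mul, Real.exp_log hε1]
  refine (mul_le_mul_of_nonneg_left hsum (Real.exp_pos _).le).trans (le_of_eq ?_)
  rw [← Real.exp_add, hent]
  congr 1
  ring

end Entropy

/-! ### Achievable rates and the capacity bound. -/

section Capacity

variable {F : Type*} [Field F] [Fintype F] [DecidableEq F]

theorem codingError_one {b : Type*} [Fintype b] [DecidableEq b] [Nonempty b]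
    {T : Matrix b b ℂ →ₗ[ℂ] Matrix b b ℂ} (hT : T 1 = 1) : codingError T 1 = 0 := by
  obtain ⟨y₀⟩ := ‹Nonempty b›
  let KE : Unit → Matrix b (Fin 1) ℂ := fun _ => Matrix.single y₀ 0 1
  let KD : b → Matrix (Fin 1) b ℂ := fun y => Matrix.single 0 y 1
  have hE : ∑ j, (KE j)ᴴ * KE j = 1 := by
    ext i j
    simp [KE, Matrix.one_apply, Subsingleton.elim i 0, Subsingleton.elim j 0]
  have hD : ∑ j, (KD j)ᴴ * KD j = 1 := by
    ext i j
    simp [KD, Matrix.sum_apply, Matrix.single_apply, Matrix.one_apply, ite_and]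
  have hEc := isChannel_krausMap KE hE
  have hDc := isChannel_krausMap KD hD
  have h0 : krausMap KE ∘ₗ T ∘ₗ krausMap KD - LinearMap.id = 0 := by
    refine sub_eq_zero.2 (LinearMap.ext fun A => ?_)
    have hA : A = A 0 0 • (1 : Matrix (Fin 1) (Fin 1) ℂ) := by
      ext i j
      simp [Subsingleton.elim i 0, Subsingleton.elim j 0]
    rw [hA, map_smul, map_smul]
    simp only [LinearMap.comp_apply, hDc.unital, hT, hEc.unital, LinearMap.id_apply]
  refine le_antisymm ?_ zero_le
  refine (iInf_le_of_le (krausMap KE) (iInf_le_of_le (krausMap KD)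
    (iInf_le_of_le hEc (iInf_le_of_le hDc le_rfl)))).trans ?_
  rw [h0]
  have hb : CbBound (0 : Matrix (Fin 1) (Fin 1) ℂ →ₗ[ℂ] Matrix (Fin 1) (Fin 1) ℂ) 0 := by
    simpa using CbBound.sum (s := (∅ : Finset Unit))
      (T := fun _ => (0 : Matrix (Fin 1) (Fin 1) ℂ →ₗ[ℂ] Matrix (Fin 1) (Fin 1) ℂ))
      (C := fun _ => 0) (by simp)
  simpa using hb.cbNorm_le le_rfl

theorem isAchievableRate_zero {b : Type*} [Fintype b] [DecidableEq b] [Nonempty b]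
    {T : Matrix b b ℂ →ₗ[ℂ] Matrix b b ℂ} (hT : T 1 = 1) : IsAchievableRate T 0 := by
  refine ⟨le_rfl, ?_⟩
  have h : ∀ n : ℕ, codingError (tensorPower T n) ⌊(2 : ℝ) ^ ((0 : ℝ) * (n : ℝ))⌋₊ = 0 := by
    intro n
    rw [zero_mul, Real.rpow_zero, Nat.floor_one]
    exact codingError_one (tensorPower_one T hT)
  simp only [h]
  exact tendsto_const_nhds

theorem exists_isPureCode {χ : AddChar F ℂ} (hχ : χ.IsPrimitive) {n k f M : ℕ} (hf : 2 * f ≤ n)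
    (h : n.choose (2 * f) * Fintype.card F ^ (2 * (2 * f) + k) < Fintype.card F ^ n)
    (hM : M ≤ Fintype.card F ^ k) : ∃ V : Matrix (Fin n → F) (Fin M) ℂ, IsPureCode χ f V := by
  obtain ⟨G, B, hGB⟩ := exists_detectsErrors (F := F) hf h
  obtain ⟨u⟩ : Nonempty (Fin M ↪ (Fin k → F)) :=
    Function.Embedding.nonempty_of_card_le (by simpa using hM)
  exact ⟨_, hGB.isPureCode hχ u.injective⟩

/-- The Gilbert–Varshamov inequality holds for all large block lengths below the rate bound. -/
theorem eventually_choose_mul_lt {q : ℕ} (hq : 2 ≤ q) {ε c : ℝ} (hε0 : 0 < ε) (hε : ε ≤ 1 / 4)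
    (hc0 : 0 ≤ c) (hc : c < (1 - 4 * ε) * Real.log q - Real.binEntropy (2 * ε)) :
    ∀ᶠ n : ℕ in Filter.atTop, 2 * ⌊ε * n⌋₊ ≤ n ∧
      n.choose (2 * ⌊ε * n⌋₊) * q ^ (2 * (2 * ⌊ε * n⌋₊) + ⌈c * n / Real.log q⌉₊) < q ^ n := by
  have hq1 : (1 : ℝ) < q := by exact_mod_cast (by omega : 1 < q)
  have hlq : 0 < Real.log q := Real.log_pos hq1
  have hgap : 0 < (1 - 4 * ε) * Real.log q - Real.binEntropy (2 * ε) - c := by linarith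
  -- From `N` on, the linear gain from the rate gap exceeds `log q`, the cost of rounding `k` up.
  obtain ⟨N, hN⟩ := exists_nat_gt
    (Real.log q / ((1 - 4 * ε) * Real.log q - Real.binEntropy (2 * ε) - c))
  filter_upwards [Filter.eventually_ge_atTop N] with n hn
  have hn' : Real.log q < n * ((1 - 4 * ε) * Real.log q - Real.binEntropy (2 * ε) - c) := by
    rw [← div_lt_iff₀ hgap]
    exact hN.trans_le (by exact_mod_cast hn)
  have hn0 : (0 : ℝ) ≤ n := Nat.cast_nonneg n
  have hfl : (⌊ε * n⌋₊ : ℝ) ≤ ε * n := Nat.floor_le (by positivity)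
  have hr : ((2 * ⌊ε * n⌋₊ : ℕ) : ℝ) ≤ 2 * ε * n := by
    push_cast
    linarith
  have hrn : 2 * ⌊ε * n⌋₊ ≤ n := by
    have : ((2 * ⌊ε * n⌋₊ : ℕ) : ℝ) ≤ n := hr.trans (by nlinarith)
    exact_mod_cast this
  refine ⟨hrn, ?_⟩
  have hchoose := choose_le_exp_binEntropy hrn (by linarith : 0 < 2 * ε) (by linarith) hr
  have hk : (⌈c * n / Real.log q⌉₊ : ℝ) < c * n / Real.log q + 1 := Nat.ceil_lt_add_one (by positivity)
  have hk' : (⌈c * n / Real.log q⌉₊ : ℝ) * Real.log q ≤ c * n + Real.log q := by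
    have := mul_le_mul_of_nonneg_right hk.le hlq.le
    rwa [add_mul, one_mul, div_mul_cancel₀ _ hlq.ne'] at this
  have hpow : ∀ m : ℕ, (q : ℝ) ^ m = Real.exp (m * Real.log q) := by
    intro m
    rw [Real.exp_nat_mul, Real.exp_log (by linarith)]
  have hreal : (n.choose (2 * ⌊ε * n⌋₊) : ℝ) *
      (q : ℝ) ^ (2 * (2 * ⌊ε * n⌋₊) + ⌈c * n / Real.log q⌉₊) < (q : ℝ) ^ n := by
    rw [hpow, hpow]
    refine (mul_le_mul_of_nonneg_right hchoose (Real.exp_pos _).le).trans_lt ?_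
    rw [← Real.exp_add, Real.exp_lt_exp, Nat.cast_add, Nat.cast_mul, Nat.cast_two]
    have := mul_le_mul_of_nonneg_right hr hlq.le
    nlinarith
  exact_mod_cast hreal

theorem isAchievableRate_of_lt {T : Matrix F F ℂ →ₗ[ℂ] Matrix F F ℂ} (hT : T 1 = 1) {ε : ℝ}
    (hε0 : 0 < ε) (hε : ε < 1 / 2)
    (hTε : cbNorm (LinearMap.id - T) < ENNReal.ofReal ((2 : ℝ) ^ (-shannonEntropy ε / ε)))
    {c : ℝ} (hc0 : 0 ≤ c)
    (hc : c < (1 - 4 * ε) * Real.logb 2 (Fintype.card F) - shannonEntropy (2 * ε)) :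
    IsAchievableRate T c := by
  obtain ⟨χ, hχ1⟩ := AddChar.exists_apply_ne_zero.2 (one_ne_zero : (1 : F) ≠ 0)
  have hχ : χ.IsPrimitive := AddChar.IsPrimitive.of_ne_one fun h => hχ1 (by simp [h])
  have hl2 : 0 < Real.log 2 := Real.log_pos one_lt_two
  set q := Fintype.card F with hq
  have hq2 : 2 ≤ q := Fintype.one_lt_card
  have hlq : 0 < Real.log q := Real.log_pos (by exact_mod_cast (by omega : 1 < q))
  -- The cb norm may be `0`; a positive `δ` strictly below the threshold keeps `log δ` meaningful.
  obtain ⟨δ, hδ0, hTδ, hδ⟩ : ∃ δ : ℝ, 0 < δ ∧ cbNorm (LinearMap.id - T) ≤ ENNReal.ofReal δ ∧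
      δ < (2 : ℝ) ^ (-shannonEntropy ε / ε) := by
    obtain ⟨δ, hδ1, hδ2⟩ := exists_between hTε
    have hfin : δ ≠ ⊤ := (hδ2.trans_le le_top).ne
    refine ⟨δ.toReal, ENNReal.toReal_pos (zero_le.trans_lt hδ1).ne' hfin, ?_, ?_⟩
    · rw [ENNReal.ofReal_toReal hfin]
      exact hδ1.le
    · rwa [← ENNReal.ofReal_toReal hfin, ENNReal.ofReal_lt_ofReal_iff (by positivity)] at hδ2
  have hδlog : ε * Real.log δ < -Real.binEntropy ε := by
    have h1 := Real.log_lt_log hδ0 hδ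
    rw [Real.log_rpow two_pos, shannonEntropy_eq] at h1
    have h2 : -(Real.binEntropy ε / Real.log 2) / ε * Real.log 2 = -Real.binEntropy ε / ε := by
      field_simp
    rw [h2, lt_div_iff₀ hε0] at h1
    linarith
  have hcb : CbBound (T - LinearMap.id) δ := by
    have := (cbBound_of_cbNorm_le hδ0.le hTδ).neg
    rwa [neg_sub] at this
  have hc' : c * Real.log 2 < (1 - 4 * ε) * Real.log q - Real.binEntropy (2 * ε) := by
    have h1 := mul_lt_mul_of_pos_right hc hl2
    rw [shannonEntropy_eq, Real.logb, sub_mul, div_mul_cancel₀ _ hl2.ne', mul_assoc,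
      div_mul_cancel₀ _ hl2.ne'] at h1
    exact h1
  -- A nonnegative rate below the bound forces this; it puts `2ε` in the range `≤ 1/2` of the
  -- binomial estimate.
  have hε4 : ε ≤ 1 / 4 := by
    have h1 := Real.binEntropy_nonneg (p := 2 * ε) (by linarith) (by linarith)
    have h2 : 0 ≤ c * Real.log 2 := by positivity
    have h3 : 0 < (1 - 4 * ε) * Real.log q := by linarith
    have := pos_of_mul_pos_left h3 hlq.le
    linarith
  have hev := eventually_choose_mul_lt hq2 hε0 hε4 (by positivity) hc'
  refine ⟨hc0, ?_⟩
  have hlim : Filter.Tendsto (fun n : ℕ => ENNReal.ofReal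
      (Real.exp (n * (ε * Real.log δ + Real.binEntropy ε)))) Filter.atTop (nhds 0) := by
    rw [← ENNReal.ofReal_zero]
    refine ENNReal.tendsto_ofReal (Real.tendsto_exp_atBot.comp ?_)
    exact tendsto_natCast_atTop_atTop.atTop_mul_const_of_neg (by linarith)
  refine tendsto_of_tendsto_of_tendsto_of_le_of_le' tendsto_const_nhds hlim
    (Filter.Eventually.of_forall fun _ => zero_le) ?_
  filter_upwards [hev] with n hn
  have hn0 : (0 : ℝ) ≤ n := Nat.cast_nonneg n
  have hM0 : 0 < ⌊(2 : ℝ) ^ (c * (n : ℝ))⌋₊ :=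
    Nat.floor_pos.2 (Real.one_le_rpow one_le_two (by positivity))
  have hM : ⌊(2 : ℝ) ^ (c * (n : ℝ))⌋₊ ≤ q ^ ⌈c * Real.log 2 * n / Real.log q⌉₊ := by
    have h1 : (2 : ℝ) ^ (c * (n : ℝ)) ≤ (q : ℝ) ^ ⌈c * Real.log 2 * n / Real.log q⌉₊ := by
      rw [Real.rpow_def_of_pos two_pos, ← Real.exp_log (by positivity : (0 : ℝ) < q),
        ← Real.exp_nat_mul, Real.exp_le_exp, Real.exp_log (by positivity : (0 : ℝ) < q)]
      have h2 := mul_le_mul_of_nonneg_right (Nat.le_ceil (c * Real.log 2 * n / Real.log q)) hlq.le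
      rw [div_mul_cancel₀ _ hlq.ne'] at h2
      linarith
    have h3 := (Nat.floor_le (by positivity)).trans h1
    exact_mod_cast h3
  obtain ⟨V, hV⟩ := exists_isPureCode hχ hn.1 hn.2 hM
  exact (hV.codingError_le hχ hM0 hT hδ0.le hcb).trans
    (ENNReal.ofReal_le_ofReal (sum_pow_card_le hε0 hε hδ0 hδlog))

/-- The bound can be negative; rate `0` is always achievable, by one-dimensional codes, so only `c ≥
0` needs the coding argument. -/
theorem le_quantumCapacity {T : Matrix F F ℂ →ₗ[ℂ] Matrix F F ℂ} (hT : T 1 = 1) {ε : ℝ}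
    (hε0 : 0 < ε) (hε : ε < 1 / 2)
    (hTε : cbNorm (LinearMap.id - T) < ENNReal.ofReal ((2 : ℝ) ^ (-shannonEntropy ε / ε))) :
    (((1 - 4 * ε) * Real.logb 2 (Fintype.card F) - shannonEntropy (2 * ε) : ℝ) : EReal) ≤
      quantumCapacity T := by
  by_contra! hlt
  have h0 : ((0 : ℝ) : EReal) ≤ quantumCapacity T :=
    le_sSup ⟨0, isAchievableRate_zero hT, rfl⟩
  obtain ⟨c, hc1, hc2⟩ := EReal.lt_iff_exists_real_btwn.1 hlt
  have hc0 : 0 ≤ c := EReal.coe_le_coe_iff.1 (h0.trans hc1.le)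
  have hc := isAchievableRate_of_lt hT hε0 hε hTε hc0 (EReal.coe_lt_coe_iff.1 hc2)
  exact hc1.not_ge (le_sSup ⟨c, hc, rfl⟩)

theorem exists_pos_rate {q : ℕ} (hq : 2 ≤ q) : ∃ ε : ℝ, 0 < ε ∧ ε < 1 / 2 ∧
    0 < (1 - 4 * ε) * Real.logb 2 q - shannonEntropy (2 * ε) := by
  have hcont : Continuous fun ε : ℝ => (1 - 4 * ε) * Real.logb 2 q - shannonEntropy (2 * ε) := by
    simp only [shannonEntropy_eq]
    fun_prop
  have h0 : 0 < (1 - 4 * (0 : ℝ)) * Real.logb 2 q - shannonEntropy (2 * 0) := by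
    have : 0 < Real.logb 2 q := Real.logb_pos one_lt_two (by exact_mod_cast (by omega : 1 < q))
    simpa [shannonEntropy_eq] using this
  have h1 := ((hcont.tendsto 0).eventually (lt_mem_nhds h0)).filter_mono
    (nhdsWithin_le_nhds (s := Set.Ioi 0))
  have h2 : ∀ᶠ ε : ℝ in nhdsWithin 0 (Set.Ioi 0), ε ∈ Set.Ioo (0 : ℝ) (1 / 2) :=
    Ioo_mem_nhdsGT (by norm_num)
  obtain ⟨ε, hε1, hε2⟩ := (h1.and h2).exists
  exact ⟨ε, hε2.1, hε2.2, hε1⟩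

end Capacity

end QuantumChannel

theorem mainTheorem2 (d : ℕ) (hd : d.Prime) :
    (∀ T : Matrix (Fin d) (Fin d) ℂ →ₗ[ℂ] Matrix (Fin d) (Fin d) ℂ,
      QuantumChannel.IsChannel T →
      ∀ ε : ℝ, 0 < ε → ε < 1 / 2 →
        QuantumChannel.cbNorm (LinearMap.id - T) <
          ENNReal.ofReal ((2 : ℝ) ^ (-QuantumChannel.shannonEntropy ε / ε)) →
        (((1 - 4 * ε) * Real.logb 2 (d : ℝ) - QuantumChannel.shannonEntropy (2 * ε) : ℝ) : EReal) ≤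
          QuantumChannel.quantumCapacity T) ∧
    (∃ δ : ℝ, 0 < δ ∧
      ∀ T : Matrix (Fin d) (Fin d) ℂ →ₗ[ℂ] Matrix (Fin d) (Fin d) ℂ,
        QuantumChannel.IsChannel T →
        QuantumChannel.cbNorm (LinearMap.id - T) < ENNReal.ofReal δ →
        0 < QuantumChannel.quantumCapacity T) := by
  have main : ∀ T : Matrix (Fin d) (Fin d) ℂ →ₗ[ℂ] Matrix (Fin d) (Fin d) ℂ,
      QuantumChannel.IsChannel T →
      ∀ ε : ℝ, 0 < ε → ε < 1 / 2 →
        QuantumChannel.cbNorm (LinearMap.id - T) <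
          ENNReal.ofReal ((2 : ℝ) ^ (-QuantumChannel.shannonEntropy ε / ε)) →
        (((1 - 4 * ε) * Real.logb 2 (d : ℝ) - QuantumChannel.shannonEntropy (2 * ε) : ℝ) : EReal) ≤
          QuantumChannel.quantumCapacity T := by
    have : Fact d.Prime := ⟨hd⟩
    let e : Fin d ≃ ZMod d := (ZMod.finEquiv d).toEquiv
    -- The field `ZMod d` is transported to `Fin d`, so that basis labels carry the arithmetic of
    -- the codes.
    let _ : Field (Fin d) := e.field
    intro T hT ε hε0 hε hTε
    have h := QuantumChannel.le_quantumCapacity hT.unital hε0 hε hTε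
    rwa [Fintype.card_fin] at h
  refine ⟨main, ?_⟩
  obtain ⟨ε, hε0, hε, hpos⟩ := QuantumChannel.exists_pos_rate hd.two_le
  refine ⟨(2 : ℝ) ^ (-QuantumChannel.shannonEntropy ε / ε), by positivity, fun T hT hTδ => ?_⟩
  exact lt_of_lt_of_le (EReal.coe_lt_coe_iff.2 hpos) (main T hT ε hε0 hε hTδ)
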